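/- Notation. $\mathbb D$ is the open unit disk, $\mathbb T$ the unit circle (so $\mathbb T^2$ is the distinguished boundary of the bidisk $\mathbb D^2$). $A(\mathbb D)$ and $A(\mathbb D^2)$ are the disk and bidisk algebras: functions holomorphic in $\mathbb D$ (resp. $\mathbb D^2$) and continuous on $\overline{\mathbb D}$ (resp. $\overline{\mathbb D}^2$). $H^2(\mathbb D^2)$ is the space of functions $f(z)=\sum_{j,k\ge 0}a_{j,k}z_1^jz_2^k$ on $\mathbb D^2$ with $\|f\|^2=\sum|a_{j,k}|^2<\infty$, and $C_\Phi f=f\circ\Phi$ for a holomorphic map $\Phi:\mathbb D^2\to\mathbb D^2$. Such a $\Phi$ is non-degenerate if its complex Jacobian determinant is not identically $0$ on $\mathbb D^2$. For a bounded operator $T$ and $n\ge1$, $a_n(T)=\inf\{\|T-R\| : \operatorname{rank}R<n\}$, and $\beta_2^+(T)=\limsup_{n\to\infty}[a_{n^2}(T)]^{1/n}$. The cusp map $\chi$ is given on $\mathbb D$, with principal square root and logarithm, by $$\chi_0(z)=\frac{\big(\frac{z-i}{iz-1}\big)^{1/2}-i}{-i\big(\frac{z-i}{iz-1}\big)^{1/2}+1},\qquad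 \chi(z)=1-\frac{1}{1-\frac2\pi\log\chi_0(z)},$$ and on $\overline{\mathbb D}$ by continuous extension. For $0<\theta<1$ let $\varphi(z)=\exp(-(1-z)^{-\theta})$ for $z\in\overline{\mathbb D}\setminus\{1\}$ (principal power) and $\varphi(1)=0$. Theorem. Let $0<\theta<1$. All sufficiently small $c>0$ satisfy $$|\chi(z)|+2c\,|\varphi(\chi(z))|<1\quad\text{for all } z\in\mathbb D. \qquad (*)$$ Let $c\in(0,1)$ satisfy $(*)$, let $g\in A(\mathbb D)$ with $\|g\|_\infty\le1$, and put, on $\overline{\mathbb D}^2$, $$\Phi(z_1,z_2)=\big(\chi(z_1),\ \chi(z_1)+c\,\varphi(\chi(z_1))\,g(z_2)\big).$$ Then: 1) $\Phi(\mathbb D^2)\subseteq\mathbb D^2$, and $C_\Phi$ is a bounded and compact operator on $H^2(\mathbb D^2)$; 2) both components of $\Phi$ belong to $A(\mathbb D^2)$, and $\Phi$ is non-degenerate whenever $g$ is not constant; 3) $\Phi(1,1)=(1,1)$; in particular $\Phi(\mathbb T^2)\cap\mathbb T^2\ne\emptyset$; 4) there are $\tau>0$ and $C>0$ with $a_{n^2}(C_\Phi)\le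 C e^{-\tau n}$ for all $n\ge1$, and consequently $\beta_2^+(C_\Phi)<1$. -/

import Mathlib

open Set Filter Topology Metric

noncomputable section

/-! Domains -/

/-- The open bidisk `𝔻²`. -/
def bidisk : Set (ℂ × ℂ) := ball (0 : ℂ) 1 ×ˢ ball (0 : ℂ) 1

/-- The closed bidisk. -/
def closedBidisk : Set (ℂ × ℂ) := closedBall (0 : ℂ) 1 ×ˢ closedBall (0 : ℂ) 1

/-- The torus `𝕋² = {(z₁, z₂) : |z₁| = |z₂| = 1}`, i.e. the distinguished boundary of `𝔻²`. -/
def torus : Set (ℂ × ℂ) := sphere (0 : ℂ) 1 ×ˢ sphere (0 : ℂ) 1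

/-- The disk algebra `A(𝔻)`: holomorphic in the open disk and continuous on the closed disk
(values outside the closed disk are irrelevant). -/
def InDiskAlgebra (f : ℂ → ℂ) : Prop :=
  DifferentiableOn ℂ f (ball 0 1) ∧ ContinuousOn f (closedBall 0 1)

/-- The bidisk algebra `A(𝔻²)`. -/
def InBidiskAlgebra (f : ℂ × ℂ → ℂ) : Prop :=
  DifferentiableOn ℂ f bidisk ∧ ContinuousOn f closedBidisk

/-- `Φ` is non-degenerate: its complex Jacobian determinant is not identically `0` on `𝔻²`. -/
def NonDegenerate (Φ : ℂ × ℂ → ℂ × ℂ) : Prop :=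
  ∃ z ∈ bidisk, (fderiv ℂ Φ z).det ≠ 0

/-! Hardy space of the bidisk and composition operators -/

/-- The Hardy space `H²(𝔻²)`: the functions `∑ a_{j,k} z₁ʲ z₂ᵏ` with `‖f‖² = ∑ |a_{j,k}|² < ∞`,
an element being recorded by its square-summable family of Taylor coefficients. The function
itself is `HardyBidisk.eval f`, and it determines `f` (`HardyBidisk.eval_injective`). -/
abbrev HardyBidisk : Type := lp (fun _ : ℕ × ℕ => ℂ) 2

/-- The value at `z` of the function with the given coefficients (the sum converges
absolutely on `𝔻²`, see `HardyBidisk.summable_eval`). -/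
def HardyBidisk.eval (f : HardyBidisk) (z : ℂ × ℂ) : ℂ :=
  ∑' α : ℕ × ℕ, f α * (z.1 ^ α.1 * z.2 ^ α.2)

/-- The bounded operator `T` on `H²(𝔻²)` is the composition operator `C_Φ : f ↦ f ∘ Φ`.
For a self-map `Φ` of `𝔻²` there is at most one such `T` (`IsCompositionOperator.unique`). -/
def IsCompositionOperator (Φ : ℂ × ℂ → ℂ × ℂ) (T : HardyBidisk →L[ℂ] HardyBidisk) : Prop :=
  ∀ f : HardyBidisk, ∀ z ∈ bidisk, HardyBidisk.eval (T f) z = HardyBidisk.eval f (Φ z)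

theorem HardyBidisk.summable_eval (f : HardyBidisk) {z : ℂ × ℂ} (hz : z ∈ bidisk) :
    Summable fun α : ℕ × ℕ => f α * (z.1 ^ α.1 * z.2 ^ α.2) := by
  have h1 : ‖z.1‖ < 1 := by simpa using hz.1
  have h2 : ‖z.2‖ < 1 := by simpa using hz.2
  have hs : Summable fun α : ℕ × ℕ => ‖z.1‖ ^ α.1 * ‖z.2‖ ^ α.2 :=
    (summable_geometric_of_lt_one (norm_nonneg _) h1).mul_of_nonneg
      (summable_geometric_of_lt_one (norm_nonneg _) h2)
      (fun _ => by positivity) (fun _ => by positivity)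
  refine Summable.of_norm_bounded (hs.mul_left ‖f‖) fun α => ?_
  rw [norm_mul, norm_mul, norm_pow, norm_pow]
  gcongr
  exact lp.norm_apply_le_norm (by norm_num) f α

theorem coeff_eq_zero_of_tsum_eq_zero (a : ℕ → ℂ)
    (h : ∀ w : ℂ, ‖w‖ < 1 → HasSum (fun n => w ^ n * a n) 0) (n : ℕ) : a n = 0 := by
  have hp : HasFPowerSeriesAt (fun _ : ℂ => (0 : ℂ))
      (FormalMultilinearSeries.ofScalars ℂ a) (0 : ℂ) := by
    rw [hasFPowerSeriesAt_iff]
    filter_upwards [ball_mem_nhds (0 : ℂ) one_pos] with w hw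
    simpa using h w (by simpa using hw)
  have h0 := hp.eq_zero
  have h1 := congrArg (fun q => FormalMultilinearSeries.coeff q n) h0
  rw [FormalMultilinearSeries.coeff_ofScalars] at h1
  rw [h1]; rfl

theorem HardyBidisk.eval_injective {f g : HardyBidisk}
    (h : ∀ z ∈ bidisk, HardyBidisk.eval f z = HardyBidisk.eval g z) : f = g := by
  have key : ∀ z ∈ bidisk,
      HasSum (fun α : ℕ × ℕ => (f α - g α) * (z.1 ^ α.1 * z.2 ^ α.2)) 0 := by
    intro z hz
    have h1 := ((f.summable_eval hz).hasSum).sub ((g.summable_eval hz).hasSum)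
    have h2 := h z hz
    unfold HardyBidisk.eval at h2
    rw [h2, sub_self] at h1
    simpa [sub_mul] using h1
  have inner : ∀ z ∈ bidisk, ∀ j : ℕ,
      Summable fun k : ℕ => z.2 ^ k * (f (j, k) - g (j, k)) := by
    intro z hz j
    have hz' : ((1 / 2 : ℂ), z.2) ∈ bidisk := ⟨by simp; norm_num, hz.2⟩
    have h1 := ((key _ hz').summable.prod_factor j).mul_left (2 ^ j : ℂ)
    refine h1.congr fun k => ?_
    have : (2 : ℂ) ^ j * (1 / 2) ^ j = 1 := by rw [← mul_pow]; norm_num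
    linear_combination ((f (j, k) - g (j, k)) * z.2 ^ k) * this
  have step : ∀ w : ℂ, ‖w‖ < 1 → ∀ j : ℕ,
      HasSum (fun k : ℕ => w ^ k * (f (j, k) - g (j, k))) 0 := by
    intro w hw j
    have hs : ∀ j : ℕ, Summable fun k : ℕ => w ^ k * (f (j, k) - g (j, k)) := fun j =>
      inner (0, w) ⟨by simp, by simpa using hw⟩ j
    have h0 := coeff_eq_zero_of_tsum_eq_zero
      (fun j => ∑' k : ℕ, w ^ k * (f (j, k) - g (j, k))) (fun v hv => ?_) j
    · rw [← h0]; exact (hs j).hasSum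
    · refine (key (v, w) ⟨by simpa using hv, by simpa using hw⟩).prod_fiberwise fun j => ?_
      have := (hs j).hasSum.mul_left (v ^ j)
      refine this.congr_fun ?_
      intro k
      ring
  ext ⟨j, k⟩
  exact sub_eq_zero.mp
    (coeff_eq_zero_of_tsum_eq_zero (fun k => f (j, k) - g (j, k)) (fun w hw => step w hw j) k)

theorem IsCompositionOperator.unique {Φ : ℂ × ℂ → ℂ × ℂ}
    {T S : HardyBidisk →L[ℂ] HardyBidisk} (hT : IsCompositionOperator Φ T)
    (hS : IsCompositionOperator Φ S) : T = S := by
  ext1 f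
  exact HardyBidisk.eval_injective fun z hz => (hT f z hz).trans (hS f z hz).symm

/-! Approximation numbers -/

/-- The `n`-th approximation number (`n ≥ 1`): the distance, in operator norm, from `T` to the
bounded operators of rank `< n`. -/
def approximationNumber {E F : Type*} [NormedAddCommGroup E] [NormedSpace ℂ E]
    [NormedAddCommGroup F] [NormedSpace ℂ F] (n : ℕ) (T : E →L[ℂ] F) : ℝ :=
  sInf {r : ℝ | ∃ R : E →L[ℂ] F, (R : E →ₗ[ℂ] F).rank < (n : Cardinal) ∧ r = ‖T - R‖}

/-- `β_N⁺(T) = limsup_{n → ∞} a_{n^N}(T)^{1/n}`, as an extended non-negative number. -/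
def betaPlus {E F : Type*} [NormedAddCommGroup E] [NormedSpace ℂ E]
    [NormedAddCommGroup F] [NormedSpace ℂ F] (N : ℕ) (T : E →L[ℂ] F) : ENNReal :=
  limsup (fun n : ℕ => ENNReal.ofReal (approximationNumber (n ^ N) T ^ (1 / (n : ℝ)))) atTop

/-! The cusp map and the symbol -/

/-- The conformal map of `𝔻` onto the right half-disk `{|z| < 1, Re z > 0}` (principal square
root of a point of the upper half-plane). -/
def cuspHalfDisk (z : ℂ) : ℂ :=
  (((z - Complex.I) / (Complex.I * z - 1)) ^ (1 / 2 : ℂ) - Complex.I) /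
    (-Complex.I * ((z - Complex.I) / (Complex.I * z - 1)) ^ (1 / 2 : ℂ) + 1)

/-- The cusp map on the open disk, `1 - 1 / (1 - (2/π) log χ₀)`. -/
def cuspFormula (z : ℂ) : ℂ :=
  1 - 1 / (-(2 / (Real.pi : ℂ)) * Complex.log (cuspHalfDisk z) + 1)

/-- The cusp map `χ`, extended to the closed disk by its limits from the open disk. -/
def cuspMap : ℂ → ℂ := extendFrom (ball (0 : ℂ) 1) cuspFormula

open Classical in
/-- `φ_θ(z) = exp(-(1 - z)^{-θ})` (principal power), with `φ_θ(1) = 0`. -/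
def phi (θ : ℝ) (z : ℂ) : ℂ :=
  if z = 1 then 0 else Complex.exp (-((1 - z) ^ (-(θ : ℂ))))

/-- The smallness condition on `c`: `|χ(z)| + 2c |φ_θ(χ(z))| < 1` on `𝔻`. -/
def CuspAdmissible (θ c : ℝ) : Prop :=
  ∀ z ∈ ball (0 : ℂ) 1, ‖cuspMap z‖ + 2 * c * ‖phi θ (cuspMap z)‖ < 1

/-- `Φ(z₁, z₂) = (χ(z₁), χ(z₁) + c φ_θ(χ(z₁)) g(z₂))`. -/
def cuspSymbol (θ c : ℝ) (g : ℂ → ℂ) (z : ℂ × ℂ) : ℂ × ℂ :=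
  (cuspMap z.1, cuspMap z.1 + (c : ℂ) * phi θ (cuspMap z.1) * g z.2)

end

/-!
Write `ζ = χ(z₁) = 1 - 1 / u`. The point `u` (`cuspStrip`) lies in the half-strip
`{Re u > 1, |Im u| < 1}`, so `1 - |ζ|` is comparable to `1 / X` with `X = Re u`, whereas
`|φ(ζ)| ≤ exp (-γ X^θ)` with `γ = cos (θ π / 2) > 0`. This gives the smallness condition for small
`c`; conversely the condition leaves room for a weight: `c |φ(ζ)| exp (δ X^θ) ≤ (3/5) (1 - |ζ|)` for
some `δ > 0` (`exists_weight`).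

Expand along the diagonal, `f(ζ, ζ + h) = ∑ₖ a_k(f)(ζ) hᵏ`, where
`|a_k(f)(ζ)| ≤ ‖f‖ (1 - |ζ|)^{-k-2}` (`diagCoeff`). With `h = c φ(ζ) g(z₂)` this writes `f ∘ Φ` as the
series of the tensor products `A_k(z₁) g(z₂)ᵏ`, `A_k = (c φ(χ))ᵏ a_k(f)(χ)`. By the weight estimate
`|A_k| = O((3/5)ᵏ X²) ‖f‖`, and since `X` grows like a logarithm at `z₁ = 1`, this is dominated by
`(3/5)ᵏ |1 - z₁|^{-1/4}`, which is square integrable on the circle. Parseval's identity then puts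
`f ∘ Φ` in the Hardy space (`exists_hardyBidisk_tsum`), so `C_Φ` is bounded.

For the approximation numbers, impose on `f` that `a_k(f)` vanish to order `64 n` at `1 - 2⁻ʲ`
whenever `j < n` and `k 2^{θ j} ≤ n`. As `∑ⱼ n 2^{-θ j} = O(n)`, these are `O(n²)` linear conditions
(`exists_functionals`). Under them `‖f ∘ Φ‖ ≤ K Qⁿ ‖f‖` with some `Q < 1`
(`norm_diagCoeff_cusp_le`, `exists_comp_cuspSymbol`). Indeed, where `2ʲ ≤ X < 2ʲ⁺¹`, the point `ζ` is
well inside the disk of centre `1 - 2⁻ʲ` and radius `2⁻ʲ`. If zeros are imposed there, the Schwarz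
lemma gives a factor exponentially small in `n`; if `k 2^{θ j} > n`, the weight gives
`exp (-δ k X^θ) ≤ exp (-δ n)`; and if `j ≥ n`, then `X² ≤ 2⁻ⁿ X³`. Since the Hardy space is a Hilbert
space, smallness on a subspace of codimension `O(n²)` yields an approximant of rank `O(n²)`
(`exists_finite_rank_approx`). These approximants prove compactness as well.
-/

noncomputable section

universe u

/-! ### Taylor coefficients and Hardy norms -/

/-- The `n`-th Taylor coefficient at `c` of a function that is holomorphic near `c`. -/
def taylorCoeff (F : ℂ → ℂ) (c : ℂ) (n : ℕ) : ℂ := (n.factorial : ℂ)⁻¹ * iteratedDeriv n F c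

theorem hasSum_taylorCoeff {F : ℂ → ℂ} {c : ℂ} {r : ℝ} (hF : DifferentiableOn ℂ F (ball c r))
    {z : ℂ} (hz : z ∈ ball c r) : HasSum (fun n => taylorCoeff F c n * (z - c) ^ n) (F z) := by
  refine (Complex.hasSum_taylorSeries_on_ball hF hz).congr_fun fun n => ?_
  simp only [taylorCoeff, smul_eq_mul]
  ring

theorem norm_taylorCoeff_le {F : ℂ → ℂ} {c : ℂ} {r C : ℝ} (hr : 0 < r)
    (hF : DiffContOnCl ℂ F (ball c r)) (hC : ∀ z ∈ sphere c r, ‖F z‖ ≤ C) (n : ℕ) :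
    ‖taylorCoeff F c n‖ ≤ C / r ^ n := by
  have h := Complex.norm_iteratedDeriv_le_of_forall_mem_sphere_norm_le n hr hF hC
  rw [taylorCoeff, norm_mul, norm_inv, Complex.norm_natCast,
    inv_mul_le_iff₀ (by exact_mod_cast n.factorial_pos), ← mul_div_assoc]
  exact h

/-- Fourier coefficients on a circle are the rescaled Taylor coefficients. -/
theorem fourierCoeffOn_circleMap {F : ℂ → ℂ} {r : ℝ} (hr : 0 < r)
    (hF : DiffContOnCl ℂ F (ball 0 r)) (n : ℕ) :
    fourierCoeffOn Real.two_pi_pos (fun t => F (circleMap 0 r t)) n =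
      taylorCoeff F 0 n * (r : ℂ) ^ n := by
  have h := hF.circleIntegral_one_div_sub_center_pow_smul hr n
  rw [fourierCoeffOn_eq_integral]
  have hr0 : (r : ℂ) ≠ 0 := by exact_mod_cast hr.ne'
  have hi : (∮ z in C(0, r), (1 / (z - 0) ^ (n + 1)) • F z) =
      (Complex.I / (r : ℂ) ^ n) * ∫ x in (0 : ℝ)..2 * Real.pi,
        fourier (-(n : ℤ)) (x : AddCircle (2 * Real.pi - 0)) • F (circleMap 0 r x) := by
    rw [circleIntegral, ← intervalIntegral.integral_const_mul]
    congr 1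
    ext x
    rw [fourier_coe_apply, deriv_circleMap]
    have hc : circleMap 0 r x ≠ 0 := circleMap_ne_center hr.ne'
    have he : Complex.exp (2 * Real.pi * Complex.I * ((-(n : ℤ) : ℤ) : ℂ) * x /
        ((2 * Real.pi - 0 : ℝ) : ℂ)) = (r : ℂ) ^ n / circleMap 0 r x ^ n := by
      rw [circleMap, zero_add, mul_pow, ← Complex.exp_nat_mul, div_mul_cancel_left₀ (pow_ne_zero _ hr0),
        ← Complex.exp_neg]
      congr 1
      have : (Real.pi : ℂ) ≠ 0 := by exact_mod_cast Real.pi_ne_zero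
      push_cast
      field_simp
      simp
      ring
    rw [he]
    simp only [smul_eq_mul, sub_zero]
    field_simp
    ring
  rw [hi] at h
  have hp : (Real.pi : ℂ) ≠ 0 := by exact_mod_cast Real.pi_ne_zero
  have h2 : (∫ x in (0 : ℝ)..2 * Real.pi,
        fourier (-(n : ℤ)) (x : AddCircle (2 * Real.pi - 0)) • F (circleMap 0 r x)) =
      2 * Real.pi * (taylorCoeff F 0 n * (r : ℂ) ^ n) := by
    have hI := Complex.I_ne_zero
    have hn : (n.factorial : ℂ) ≠ 0 := by exact_mod_cast n.factorial_ne_zero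
    rw [smul_eq_mul] at h
    rw [taylorCoeff]
    generalize (∫ x in (0 : ℝ)..2 * Real.pi,
        fourier (-(n : ℤ)) (x : AddCircle (2 * Real.pi - 0)) • F (circleMap 0 r x)) = J at *
    field_simp at h ⊢
    linear_combination h
  rw [h2, Complex.real_smul]
  push_cast
  field_simp
  simp

/-- Bessel's inequality on the circle of radius `r`. -/
theorem sum_sq_norm_taylorCoeff_mul_pow_le {F : ℂ → ℂ} {r : ℝ} (hr : 0 < r) (hr1 : r < 1)
    (hF : DifferentiableOn ℂ F (ball 0 1)) (S : Finset ℕ) :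
    ∑ n ∈ S, (‖taylorCoeff F 0 n‖ * r ^ n) ^ 2 ≤
      (2 * Real.pi)⁻¹ * ∫ t in (0 : ℝ)..2 * Real.pi, ‖F (circleMap 0 r t)‖ ^ 2 := by
  have hsub : closedBall (0 : ℂ) r ⊆ ball 0 1 := closedBall_subset_ball hr1
  have hd : DiffContOnCl ℂ F (ball 0 r) :=
    (hF.mono (by rw [closure_ball _ hr.ne']; exact hsub)).diffContOnCl
  have hcont : Continuous fun t : ℝ => F (circleMap 0 r t) :=
    hF.continuousOn.comp_continuous (continuous_circleMap 0 r) fun t =>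
      hsub (circleMap_mem_closedBall _ hr.le t)
  have hL : MeasureTheory.MemLp (fun t : ℝ => F (circleMap 0 r t)) 2
      (MeasureTheory.volume.restrict (Ioc 0 (2 * Real.pi))) := by
    obtain ⟨C, hC⟩ := (isCompact_Icc (a := (0 : ℝ)) (b := 2 * Real.pi)).exists_bound_of_continuousOn
      hcont.continuousOn
    refine MeasureTheory.MemLp.of_bound hcont.aestronglyMeasurable C ?_
    filter_upwards [MeasureTheory.ae_restrict_mem measurableSet_Ioc] with t ht
    exact hC t (Ioc_subset_Icc_self ht)
  have hs := hasSum_sq_fourierCoeffOn Real.two_pi_pos hL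
  rw [sub_zero, smul_eq_mul] at hs
  refine le_trans (le_of_eq ?_) (sum_le_hasSum (S.map Nat.castEmbedding)
    (fun _ _ => by positivity) hs)
  rw [Finset.sum_map]
  refine Finset.sum_congr rfl fun n _ => ?_
  have := fourierCoeffOn_circleMap hr hd n
  simp only [Nat.castEmbedding_apply]
  rw [this, norm_mul, norm_pow, Complex.norm_real, Real.norm_of_nonneg hr.le]

/-- The `ℓ²` norm of the Taylor coefficients is controlled by a majorant of `|F|²` on circles. -/
theorem sum_sq_norm_taylorCoeff_le {F : ℂ → ℂ} (hF : DifferentiableOn ℂ F (ball 0 1))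
    {W : ℝ → ℝ} (hW : IntervalIntegrable W MeasureTheory.volume 0 (2 * Real.pi))
    (hle : ∀ r : ℝ, 0 < r → r < 1 → ∀ t ∈ Ioo 0 (2 * Real.pi), ‖F (circleMap 0 r t)‖ ^ 2 ≤ W t)
    (S : Finset ℕ) :
    ∑ n ∈ S, ‖taylorCoeff F 0 n‖ ^ 2 ≤
      (2 * Real.pi)⁻¹ * ∫ t in (0 : ℝ)..2 * Real.pi, W t := by
  have hlim : Tendsto (fun r : ℝ => ∑ n ∈ S, (‖taylorCoeff F 0 n‖ * r ^ n) ^ 2) (𝓝[<] 1)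
      (𝓝 (∑ n ∈ S, ‖taylorCoeff F 0 n‖ ^ 2)) := by
    have hc : Continuous fun r : ℝ => ∑ n ∈ S, (‖taylorCoeff F 0 n‖ * r ^ n) ^ 2 := by fun_prop
    have := (hc.tendsto 1).mono_left (nhdsWithin_le_nhds (s := Iio 1))
    simpa using this
  refine le_of_tendsto hlim ?_
  filter_upwards [Ioo_mem_nhdsLT (show (0 : ℝ) < 1 by norm_num)] with r hr
  refine (sum_sq_norm_taylorCoeff_mul_pow_le hr.1 hr.2 hF S).trans ?_
  gcongr
  have hsub : closedBall (0 : ℂ) r ⊆ ball 0 1 := closedBall_subset_ball hr.2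
  have hcont : Continuous fun t : ℝ => F (circleMap 0 r t) :=
    hF.continuousOn.comp_continuous (continuous_circleMap 0 r) fun t =>
      hsub (circleMap_mem_closedBall _ hr.1.le t)
  exact intervalIntegral.integral_mono_on_of_le_Ioo Real.two_pi_pos.le
    ((hcont.norm.pow 2).intervalIntegrable _ _) hW
    (hle r hr.1 hr.2)

/-- Since `|1 - re^{it}| ≥ sin (t / 2)`, Jordan's inequality bounds it below linearly in the distance
of `t` to one of the ends of `[0, 2π]`. -/
theorem norm_one_sub_circleMap_ge {r : ℝ} (hr : 0 < r) {t : ℝ}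
    (ht : t ∈ Ioo 0 (2 * Real.pi)) :
    t / Real.pi ≤ ‖1 - circleMap 0 r t‖ ∨ (2 * Real.pi - t) / Real.pi ≤ ‖1 - circleMap 0 r t‖ := by
  have hpi := Real.pi_pos
  have h1 : Real.sin (t / 2) ≤ ‖1 - circleMap 0 r t‖ := by
    have hs : 0 ≤ Real.sin (t / 2) :=
      Real.sin_nonneg_of_nonneg_of_le_pi (by linarith [ht.1]) (by linarith [ht.2])
    rw [← abs_of_nonneg hs, ← abs_of_nonneg (norm_nonneg (1 - circleMap 0 r t)), ← sq_le_sq,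
      ← Complex.normSq_eq_norm_sq, Complex.normSq_apply]
    have hre : (1 - circleMap 0 r t).re = 1 - r * Real.cos t := by
      simp [circleMap, Complex.exp_ofReal_mul_I_re]
    have him : (1 - circleMap 0 r t).im = -(r * Real.sin t) := by
      simp [circleMap, Complex.exp_ofReal_mul_I_im]
    rw [hre, him]
    have hc : Real.cos t = 1 - 2 * Real.sin (t / 2) ^ 2 := by
      have := Real.cos_two_mul (t / 2)
      rw [mul_div_cancel₀ _ (two_ne_zero)] at this
      have h := Real.sin_sq_add_cos_sq (t / 2)
      linarith
    have hsq := Real.sin_sq_add_cos_sq t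
    have hs1 : Real.sin (t / 2) ^ 2 ≤ 1 := Real.sin_sq_le_one _
    set x := Real.sin (t / 2) ^ 2
    rw [hc] at hsq ⊢
    have hx : 0 ≤ x := sq_nonneg _
    have e : (1 - r * (1 - 2 * x)) * (1 - r * (1 - 2 * x)) + -(r * Real.sin t) * -(r * Real.sin t)
        = (1 - r) ^ 2 * (1 - x) + x + 2 * r * x + r ^ 2 * x := by
      linear_combination r ^ 2 * hsq
    rw [e]
    have : 0 ≤ (1 - r) ^ 2 * (1 - x) := mul_nonneg (sq_nonneg _) (by linarith)
    have : 0 ≤ 2 * r * x + r ^ 2 * x := by positivity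
    linarith
  rcases le_total t Real.pi with h | h
  · left
    have := Real.mul_le_sin (x := t / 2) (by linarith [ht.1]) (by linarith)
    refine le_trans (le_of_eq ?_) (this.trans h1)
    field_simp
  · right
    have := Real.mul_le_sin (x := Real.pi - t / 2) (by linarith [ht.2]) (by linarith)
    rw [Real.sin_pi_sub] at this
    refine le_trans (le_of_eq ?_) (this.trans h1)
    field_simp

/-- A holomorphic function on the disk dominated by `M |1 - z|^{-1/4}` lies in the Hardy space,
with norm at most a constant times `M`. -/
theorem exists_sum_sq_norm_taylorCoeff_le : ∃ K : ℝ, 0 < K ∧ ∀ (F : ℂ → ℂ) (M : ℝ),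
    DifferentiableOn ℂ F (ball 0 1) → 0 ≤ M →
    (∀ z ∈ ball (0 : ℂ) 1, ‖F z‖ ≤ M * ‖1 - z‖ ^ (-(1 / 4) : ℝ)) →
    ∀ S : Finset ℕ, ∑ n ∈ S, ‖taylorCoeff F 0 n‖ ^ 2 ≤ (K * M) ^ 2 := by
  -- an integrable majorant of `|1 - re^{it}|^{-1/2}`, with singularities at both ends of `[0, 2π]`
  set W : ℝ → ℝ := fun t => (t / Real.pi) ^ (-(1 / 2) : ℝ) +
    ((2 * Real.pi - t) / Real.pi) ^ (-(1 / 2) : ℝ) with hWdef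
  have hpi := Real.pi_pos
  have hW : IntervalIntegrable W MeasureTheory.volume 0 (2 * Real.pi) := by
    have h0 : IntervalIntegrable (fun t : ℝ => t ^ (-(1 / 2) : ℝ)) MeasureTheory.volume 0 2 :=
      intervalIntegral.intervalIntegrable_rpow' (by norm_num)
    have h1 : IntervalIntegrable (fun t : ℝ => (t / Real.pi) ^ (-(1 / 2) : ℝ))
        MeasureTheory.volume 0 (2 * Real.pi) := by
      have := h0.comp_mul_right (c := Real.pi⁻¹)
      simpa [div_eq_mul_inv] using this
    have h2 : IntervalIntegrable (fun t : ℝ => ((2 * Real.pi - t) / Real.pi) ^ (-(1 / 2) : ℝ))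
        MeasureTheory.volume 0 (2 * Real.pi) := by
      have := h1.comp_sub_left (2 * Real.pi)
      simpa using this.symm
    exact h1.add h2
  set I := (2 * Real.pi)⁻¹ * ∫ t in (0 : ℝ)..2 * Real.pi, W t
  have hI : 0 ≤ I := by
    refine mul_nonneg (by positivity) (intervalIntegral.integral_nonneg (by positivity) ?_)
    intro t ht
    have h1 := ht.1
    have h2 := sub_nonneg.2 ht.2
    simp only [hWdef]
    positivity
  refine ⟨Real.sqrt (I + 1), by positivity, fun F M hF hM hle S => ?_⟩
  have := sum_sq_norm_taylorCoeff_le hF (hW.const_mul (M ^ 2)) (fun r hr hr1 t ht => ?_) S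
  · refine this.trans ?_
    rw [intervalIntegral.integral_const_mul, mul_pow, Real.sq_sqrt (by positivity)]
    have : (2 * Real.pi)⁻¹ * (M ^ 2 * ∫ t in (0 : ℝ)..2 * Real.pi, W t) = M ^ 2 * I := by
      simp only [I]; ring
    rw [this]
    nlinarith [sq_nonneg M]
  · have hz : circleMap 0 r t ∈ ball (0 : ℂ) 1 :=
      closedBall_subset_ball hr1 (circleMap_mem_closedBall _ hr.le t)
    have h := hle _ hz
    have hsq : ‖F (circleMap 0 r t)‖ ^ 2 ≤ M ^ 2 * ‖1 - circleMap 0 r t‖ ^ (-(1 / 2) : ℝ) := by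
      calc _ ≤ (M * ‖1 - circleMap 0 r t‖ ^ (-(1 / 4) : ℝ)) ^ 2 := by gcongr
        _ = _ := by
          rw [mul_pow, ← Real.rpow_natCast (_ ^ (_ : ℝ)), ← Real.rpow_mul (norm_nonneg _)]
          norm_num
    refine hsq.trans ?_
    gcongr
    have p1 : 0 ≤ (t / Real.pi) ^ (-(1 / 2) : ℝ) := Real.rpow_nonneg (by have := ht.1; positivity) _
    have p2 : 0 ≤ ((2 * Real.pi - t) / Real.pi) ^ (-(1 / 2) : ℝ) :=
      Real.rpow_nonneg (by have := sub_pos.2 ht.2; positivity) _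
    rcases norm_one_sub_circleMap_ge hr ht with h | h
    · have := Real.rpow_le_rpow_of_nonpos (div_pos ht.1 hpi) h (show (-(1 / 2) : ℝ) ≤ 0 by norm_num)
      simp only [hWdef]; linarith
    · have := Real.rpow_le_rpow_of_nonpos (div_pos (sub_pos.2 ht.2) hpi) h
        (show (-(1 / 2) : ℝ) ≤ 0 by norm_num)
      simp only [hWdef]; linarith

/-- A holomorphic function on the disk bounded by `1` has Hardy norm at most `1`. -/
theorem sum_sq_norm_taylorCoeff_le_one {F : ℂ → ℂ} (hF : DifferentiableOn ℂ F (ball 0 1))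
    (hle : ∀ z ∈ ball (0 : ℂ) 1, ‖F z‖ ≤ 1) (S : Finset ℕ) :
    ∑ n ∈ S, ‖taylorCoeff F 0 n‖ ^ 2 ≤ 1 := by
  have := sum_sq_norm_taylorCoeff_le hF (W := fun _ => 1) (by simp) (fun r hr hr1 t ht => by
    have := hle _ (closedBall_subset_ball hr1 (circleMap_mem_closedBall _ hr.le t))
    exact pow_le_one₀ (norm_nonneg _) this) S
  refine this.trans (le_of_eq ?_)
  have := Real.pi_ne_zero
  simp
  field_simp

/-- The tensor product of two Hardy functions of one variable. -/
theorem exists_hardyBidisk_mul {A G : ℂ → ℂ} (hA : DifferentiableOn ℂ A (ball 0 1))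
    (hG : DifferentiableOn ℂ G (ball 0 1)) {a b : ℝ} (ha : 0 ≤ a) (hb : 0 ≤ b)
    (hAS : ∀ S : Finset ℕ, ∑ n ∈ S, ‖taylorCoeff A 0 n‖ ^ 2 ≤ a ^ 2)
    (hGS : ∀ S : Finset ℕ, ∑ n ∈ S, ‖taylorCoeff G 0 n‖ ^ 2 ≤ b ^ 2) :
    ∃ F : HardyBidisk, (∀ z ∈ bidisk, F.eval z = A z.1 * G z.2) ∧ ‖F‖ ≤ a * b := by
  have hS : ∀ S : Finset (ℕ × ℕ),
      ∑ p ∈ S, ‖taylorCoeff A 0 p.1 * taylorCoeff G 0 p.2‖ ^ 2 ≤ (a * b) ^ 2 := by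
    intro S
    calc _ ≤ ∑ p ∈ (S.image Prod.fst) ×ˢ (S.image Prod.snd),
          ‖taylorCoeff A 0 p.1 * taylorCoeff G 0 p.2‖ ^ 2 :=
          Finset.sum_le_sum_of_subset_of_nonneg S.subset_product fun _ _ _ => by positivity
      _ = (∑ n ∈ S.image Prod.fst, ‖taylorCoeff A 0 n‖ ^ 2) *
          ∑ n ∈ S.image Prod.snd, ‖taylorCoeff G 0 n‖ ^ 2 := by
          rw [Finset.sum_mul_sum, Finset.sum_product]
          simp only [norm_mul, mul_pow]
      _ ≤ (a * b) ^ 2 := by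
          rw [mul_pow]
          exact mul_le_mul (hAS _) (hGS _) (Finset.sum_nonneg fun _ _ => by positivity)
            (by positivity)
  have hmem : Memℓp (fun p : ℕ × ℕ => taylorCoeff A 0 p.1 * taylorCoeff G 0 p.2) 2 :=
    memℓp_gen' (C := (a * b) ^ 2) fun S => by simpa using hS S
  obtain ⟨F, hF⟩ : ∃ F : HardyBidisk, ∀ p : ℕ × ℕ,
      F p = taylorCoeff A 0 p.1 * taylorCoeff G 0 p.2 := ⟨⟨_, hmem⟩, fun _ => rfl⟩
  refine ⟨F, fun z hz => ?_, lp.norm_le_of_forall_sum_le (by norm_num) (by positivity)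
    fun S => by simpa [hF] using hS S⟩
  have h1 := hasSum_taylorCoeff hA hz.1
  have h2 := hasSum_taylorCoeff hG hz.2
  simp only [sub_zero] at h1 h2
  have h : HasSum (fun p : ℕ × ℕ => F p * (z.1 ^ p.1 * z.2 ^ p.2)) (A z.1 * G z.2) := by
    have h3 := summable_mul_of_summable_norm (f := fun n => taylorCoeff A 0 n * z.1 ^ n)
      (g := fun n => taylorCoeff G 0 n * z.2 ^ n) h1.summable.norm h2.summable.norm
    have h4 := HasSum.mul (f := fun n => taylorCoeff A 0 n * z.1 ^ n)
      (g := fun n => taylorCoeff G 0 n * z.2 ^ n) h1 h2 h3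
    have h5 : (fun p : ℕ × ℕ => F p * (z.1 ^ p.1 * z.2 ^ p.2)) = fun p : ℕ × ℕ =>
        (taylorCoeff A 0 p.1 * z.1 ^ p.1) * (taylorCoeff G 0 p.2 * z.2 ^ p.2) := by
      funext p
      rw [hF]
      ring
    rw [h5]
    exact h4
  exact h.tsum_eq

theorem HardyBidisk.eval_add (f g : HardyBidisk) {z : ℂ × ℂ} (hz : z ∈ bidisk) :
    (f + g).eval z = f.eval z + g.eval z := by
  simp only [HardyBidisk.eval]
  rw [← (f.summable_eval hz).tsum_add (g.summable_eval hz)]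
  refine tsum_congr fun α => ?_
  rw [lp.coeFn_add, Pi.add_apply]
  ring

theorem HardyBidisk.eval_smul (c : ℂ) (f : HardyBidisk) (z : ℂ × ℂ) :
    (c • f).eval z = c * f.eval z := by
  simp only [HardyBidisk.eval]
  rw [← tsum_mul_left]
  refine tsum_congr fun α => ?_
  rw [lp.coeFn_smul, Pi.smul_apply, smul_eq_mul]
  ring

/-- Point evaluations are continuous, so they commute with norm-convergent series. -/
theorem HardyBidisk.hasSum_eval {ι : Type*} {F : ι → HardyBidisk} {G : HardyBidisk}
    (h : HasSum F G) {z : ℂ × ℂ} (hz : z ∈ bidisk) :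
    HasSum (fun i => (F i).eval z) (G.eval z) := by
  have h1 : ‖z.1‖ < 1 := by simpa using hz.1
  have h2 : ‖z.2‖ < 1 := by simpa using hz.2
  have hs : Summable fun α : ℕ × ℕ => ‖z.1‖ ^ α.1 * ‖z.2‖ ^ α.2 :=
    (summable_geometric_of_lt_one (norm_nonneg _) h1).mul_of_nonneg
      (summable_geometric_of_lt_one (norm_nonneg _) h2)
      (fun _ => by positivity) (fun _ => by positivity)
  let L : HardyBidisk →ₗ[ℂ] ℂ :=
    { toFun := fun f => f.eval z
      map_add' := fun f g => HardyBidisk.eval_add f g hz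
      map_smul' := fun c f => HardyBidisk.eval_smul c f z }
  have hb : ∀ f : HardyBidisk, ‖L f‖ ≤ (∑' α : ℕ × ℕ, ‖z.1‖ ^ α.1 * ‖z.2‖ ^ α.2) * ‖f‖ := by
    intro f
    refine tsum_of_norm_bounded (hs.hasSum.mul_right ‖f‖) fun α => ?_
    rw [norm_mul, norm_mul, norm_pow, norm_pow, mul_comm]
    gcongr
    exact lp.norm_apply_le_norm (by norm_num) f α
  exact h.mapL (L.mkContinuous _ hb)

/-- A series `∑ A_k(z₁) g(z₂)^k` with coefficients dominated by `M_k |1 - z₁|^{-1/4}` defines a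
function in the Hardy space of the bidisk: each term is a tensor product, and `g^k` has norm at
most `1`. -/
theorem exists_hardyBidisk_tsum : ∃ K : ℝ, 0 < K ∧ ∀ (A : ℕ → ℂ → ℂ) (g : ℂ → ℂ) (M : ℕ → ℝ),
    (∀ k, DifferentiableOn ℂ (A k) (ball 0 1)) → DifferentiableOn ℂ g (ball 0 1) →
    (∀ z ∈ ball (0 : ℂ) 1, ‖g z‖ ≤ 1) → (∀ k, 0 ≤ M k) → Summable M →
    (∀ k, ∀ z ∈ ball (0 : ℂ) 1, ‖A k z‖ ≤ M k * ‖1 - z‖ ^ (-(1 / 4) : ℝ)) →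
    ∃ F : HardyBidisk, (∀ z ∈ bidisk, F.eval z = ∑' k, A k z.1 * g z.2 ^ k) ∧
      ‖F‖ ≤ K * ∑' k, M k := by
  obtain ⟨K, hK, h⟩ := exists_sum_sq_norm_taylorCoeff_le
  refine ⟨K, hK, fun A g M hA hg hg1 hM hMs hle => ?_⟩
  have key : ∀ k, ∃ F : HardyBidisk, (∀ z ∈ bidisk, F.eval z = A k z.1 * g z.2 ^ k) ∧
      ‖F‖ ≤ K * M k := by
    intro k
    have := exists_hardyBidisk_mul (hA k) (hg.pow k) (mul_nonneg hK.le (hM k)) zero_le_one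
      (h (A k) (M k) (hA k) (hM k) (hle k)) (by
        simpa using sum_sq_norm_taylorCoeff_le_one (hg.pow k) fun z hz => by
          simpa using pow_le_one₀ (norm_nonneg _) (hg1 z hz))
    simpa using this
  choose F hF1 hF2 using key
  have hs : Summable F := Summable.of_norm_bounded (hMs.mul_left K) hF2
  refine ⟨∑' k, F k, fun z hz => ?_, ?_⟩
  · rw [← (HardyBidisk.hasSum_eval hs.hasSum hz).tsum_eq]
    exact tsum_congr fun k => hF1 k z hz
  · exact tsum_of_norm_bounded (hMs.hasSum.mul_left K) hF2

/-! ### The cusp map -/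

/-- The Möbius map `z ↦ (z - i)/(iz - 1)` of the disk onto the upper half-plane. -/
def cuspHalfPlane (z : ℂ) : ℂ := (z - Complex.I) / (Complex.I * z - 1)

/-- The square root `s` of `cuspHalfPlane z`, a point of the first quadrant. -/
def cuspQuadrant (z : ℂ) : ℂ := cuspHalfPlane z ^ (1 / 2 : ℂ)

/-- The map `u = 1 - (2/π) log χ₀` onto the half-strip `{Re u > 1, |Im u| < 1}`, so that
`χ = 1 - 1 / u`. -/
def cuspStrip (z : ℂ) : ℂ := -(2 / (Real.pi : ℂ)) * Complex.log (cuspHalfDisk z) + 1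

theorem cuspFormula_eq (z : ℂ) : cuspFormula z = 1 - 1 / cuspStrip z := rfl

theorem I_mul_sub_one_ne_zero {z : ℂ} (hz : z ≠ -Complex.I) : Complex.I * z - 1 ≠ 0 := by
  intro h
  apply hz
  linear_combination (-Complex.I) * h + z * Complex.I_mul_I

theorem ne_neg_I_of_mem_ball {z : ℂ} (hz : z ∈ ball (0 : ℂ) 1) : z ≠ -Complex.I := by
  rintro rfl
  simp at hz

theorem cuspHalfPlane_im {z : ℂ} :
    (cuspHalfPlane z).im = (1 - ‖z‖ ^ 2) / Complex.normSq (Complex.I * z - 1) := by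
  rw [cuspHalfPlane, Complex.div_im, ← Complex.normSq_eq_norm_sq, Complex.normSq_apply z]
  simp
  ring

theorem cuspHalfPlane_im_pos {z : ℂ} (hz : z ∈ ball (0 : ℂ) 1) : 0 < (cuspHalfPlane z).im := by
  rw [cuspHalfPlane_im]
  have h1 : ‖z‖ < 1 := by simpa using hz
  have := Complex.normSq_pos.2 (I_mul_sub_one_ne_zero (ne_neg_I_of_mem_ball hz))
  have : 0 < 1 - ‖z‖ ^ 2 := by nlinarith [norm_nonneg z]
  positivity

theorem cuspHalfPlane_ne_zero {z : ℂ} (hz : z ∈ ball (0 : ℂ) 1) : cuspHalfPlane z ≠ 0 := by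
  intro h
  have := cuspHalfPlane_im_pos hz
  simp [h] at this

theorem cpow_half_sq (w : ℂ) : (w ^ (1 / 2 : ℂ)) ^ 2 = w := by
  simp

theorem cuspQuadrant_sq (z : ℂ) : cuspQuadrant z ^ 2 = cuspHalfPlane z := cpow_half_sq _

theorem cuspQuadrant_re_im {z : ℂ} (hz : z ∈ ball (0 : ℂ) 1) :
    0 < (cuspQuadrant z).re ∧ 0 < (cuspQuadrant z).im := by
  have him := cuspHalfPlane_im_pos hz
  have hre : 0 < (cuspQuadrant z).re := by
    rw [cuspQuadrant, Complex.cpow_def_of_ne_zero (cuspHalfPlane_ne_zero hz), Complex.exp_re]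
    have h1 : (Complex.log (cuspHalfPlane z) * (1 / 2 : ℂ)).im = (cuspHalfPlane z).arg / 2 := by
      rw [show (1 / 2 : ℂ) = ((1 / 2 : ℝ) : ℂ) by push_cast; rfl, Complex.im_mul_ofReal,
        Complex.log_im]
      ring
    rw [h1]
    have h2 := Complex.arg_nonneg_iff.2 him.le
    have h3 : (cuspHalfPlane z).arg < Real.pi :=
      Complex.arg_lt_pi_iff.2 (Or.inr him.ne')
    exact mul_pos (Real.exp_pos _) (Real.cos_pos_of_mem_Ioo ⟨by linarith, by linarith⟩)
  refine ⟨hre, ?_⟩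
  have h := congrArg Complex.im (cuspQuadrant_sq z)
  rw [sq, Complex.mul_im] at h
  have : 0 < (cuspQuadrant z).re * (cuspQuadrant z).im := by linarith
  exact pos_of_mul_pos_right this hre.le

theorem add_I_ne_zero {s : ℂ} (hs : 0 ≤ s.im) : s + Complex.I ≠ 0 := by
  intro h
  have := congrArg Complex.im h
  simp at this
  linarith

theorem sub_I_div_neg_I_mul_add_one (s : ℂ) :
    (s - Complex.I) / (-Complex.I * s + 1) = Complex.I * (s - Complex.I) / (s + Complex.I) := by
  have h : -Complex.I * s + 1 = -Complex.I * (s + Complex.I) := by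
    linear_combination Complex.I_mul_I
  rw [h, neg_mul, div_neg, ← neg_div]
  by_cases h0 : s + Complex.I = 0
  · simp [h0]
  have := Complex.I_ne_zero
  rw [div_eq_div_iff (mul_ne_zero this h0) h0]
  linear_combination -(s - Complex.I) * (s + Complex.I) * Complex.I_mul_I

theorem cuspHalfDisk_eq (z : ℂ) : cuspHalfDisk z =
    Complex.I * (cuspQuadrant z - Complex.I) / (cuspQuadrant z + Complex.I) :=
  sub_I_div_neg_I_mul_add_one _

theorem cuspHalfDisk_re_pos {z : ℂ} (hz : z ∈ ball (0 : ℂ) 1) : 0 < (cuspHalfDisk z).re := by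
  obtain ⟨h1, h2⟩ := cuspQuadrant_re_im hz
  rw [cuspHalfDisk_eq, Complex.div_re]
  have := Complex.normSq_pos.2 (add_I_ne_zero h2.le)
  rw [← add_div]
  refine div_pos ?_ this
  simp
  nlinarith

theorem norm_cuspHalfDisk_lt_one {z : ℂ} (hz : z ∈ ball (0 : ℂ) 1) : ‖cuspHalfDisk z‖ < 1 := by
  obtain ⟨h1, h2⟩ := cuspQuadrant_re_im hz
  have h0 := norm_pos_iff.2 (add_I_ne_zero h2.le)
  rw [cuspHalfDisk_eq, norm_div, norm_mul, Complex.norm_I, one_mul, div_lt_one h0,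
    ← sq_lt_sq₀ (norm_nonneg _) (norm_nonneg _), ← Complex.normSq_eq_norm_sq,
    ← Complex.normSq_eq_norm_sq, Complex.normSq_apply, Complex.normSq_apply]
  simp
  nlinarith

/-- A consequence of `χ₀ (s + i)² = i (s² + 1)`, where `s² + 1 = w + 1` vanishes at `z = 1` only. -/
theorem norm_cuspHalfDisk_eq {z : ℂ} (hz : z ∈ ball (0 : ℂ) 1) :
    ‖cuspHalfDisk z‖ = ‖cuspHalfPlane z + 1‖ / ‖cuspQuadrant z + Complex.I‖ ^ 2 := by
  obtain ⟨h1, h2⟩ := cuspQuadrant_re_im hz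
  have h0 := add_I_ne_zero h2.le
  have hn := norm_ne_zero_iff.2 h0
  rw [cuspHalfDisk_eq, ← cuspQuadrant_sq]
  have : cuspQuadrant z ^ 2 + 1 = (cuspQuadrant z - Complex.I) * (cuspQuadrant z + Complex.I) := by
    linear_combination Complex.I_mul_I
  rw [this, norm_div, norm_mul, norm_mul, Complex.norm_I]
  field_simp

theorem cuspHalfPlane_add_one {z : ℂ} (hz : z ≠ -Complex.I) :
    cuspHalfPlane z + 1 = (1 + Complex.I) * (z - 1) / (Complex.I * z - 1) := by
  have := I_mul_sub_one_ne_zero hz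
  rw [cuspHalfPlane, eq_div_iff this, add_mul, div_mul_cancel₀ _ this]
  ring

/-- The half-disk coordinate vanishes at most linearly at the boundary point `1`. -/
theorem norm_one_sub_le_cuspHalfDisk {z : ℂ} (hz : z ∈ ball (0 : ℂ) 1) :
    ‖1 - z‖ / 8 ≤ ‖cuspHalfDisk z‖ := by
  obtain ⟨h1, h2⟩ := cuspQuadrant_re_im hz
  have hz1 : ‖z‖ < 1 := by simpa using hz
  have h0 := norm_pos_iff.2 (add_I_ne_zero h2.le)
  have hd := norm_pos_iff.2 (I_mul_sub_one_ne_zero (ne_neg_I_of_mem_ball hz))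
  rw [norm_cuspHalfDisk_eq hz, le_div_iff₀ (by positivity)]
  have hs : ‖cuspQuadrant z + Complex.I‖ ^ 2 ≤ 2 * (‖cuspHalfPlane z‖ + 1) := by
    have ha : ‖cuspQuadrant z + Complex.I‖ ≤ ‖cuspQuadrant z‖ + 1 := by
      simpa using norm_add_le (cuspQuadrant z) Complex.I
    rw [← cuspQuadrant_sq, norm_pow]
    nlinarith [norm_nonneg (cuspQuadrant z), sq_nonneg (‖cuspQuadrant z‖ - 1)]
  have hw : ‖cuspHalfPlane z‖ * ‖Complex.I * z - 1‖ ≤ 2 := by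
    rw [cuspHalfPlane, norm_div, div_mul_cancel₀ _ hd.ne']
    refine (norm_sub_le _ _).trans ?_
    rw [Complex.norm_I]; linarith
  have hd2 : ‖Complex.I * z - 1‖ ≤ 2 := by
    refine (norm_sub_le _ _).trans ?_
    simp; linarith
  have hone : 1 ≤ ‖(1 : ℂ) + Complex.I‖ := by
    have := Complex.abs_re_le_norm (1 + Complex.I)
    simpa using this
  rw [cuspHalfPlane_add_one (ne_neg_I_of_mem_ball hz), norm_div, norm_mul, le_div_iff₀ hd,
    norm_sub_rev z 1]
  have : ‖cuspQuadrant z + Complex.I‖ ^ 2 * ‖Complex.I * z - 1‖ ≤ 8 := by nlinarith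
  nlinarith [norm_nonneg (1 - z)]

theorem cuspHalfDisk_ne_zero {z : ℂ} (hz : z ∈ ball (0 : ℂ) 1) : cuspHalfDisk z ≠ 0 := by
  intro h
  have := cuspHalfDisk_re_pos hz
  simp [h] at this

theorem cuspStrip_re {z : ℂ} : (cuspStrip z).re = 1 - 2 / Real.pi * Real.log ‖cuspHalfDisk z‖ := by
  rw [cuspStrip, show -(2 / (Real.pi : ℂ)) = ((-(2 / Real.pi) : ℝ) : ℂ) by push_cast; rfl,
    Complex.add_re, Complex.re_ofReal_mul, Complex.log_re, Complex.one_re]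
  ring

theorem cuspStrip_im {z : ℂ} : (cuspStrip z).im = -(2 / Real.pi * (cuspHalfDisk z).arg) := by
  rw [cuspStrip, show -(2 / (Real.pi : ℂ)) = ((-(2 / Real.pi) : ℝ) : ℂ) by push_cast; rfl,
    Complex.add_im, Complex.im_ofReal_mul, Complex.log_im, Complex.one_im]
  ring

theorem one_lt_cuspStrip_re {z : ℂ} (hz : z ∈ ball (0 : ℂ) 1) : 1 < (cuspStrip z).re := by
  rw [cuspStrip_re]
  have := Real.log_neg (norm_pos_iff.2 (cuspHalfDisk_ne_zero hz)) (norm_cuspHalfDisk_lt_one hz)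
  have : 0 < 2 / Real.pi * (-Real.log ‖cuspHalfDisk z‖) :=
    mul_pos (by positivity) (by linarith)
  linarith

theorem abs_cuspStrip_im_lt {z : ℂ} (hz : z ∈ ball (0 : ℂ) 1) : |(cuspStrip z).im| < 1 := by
  rw [cuspStrip_im, abs_neg, abs_mul, abs_of_pos (by positivity)]
  have := Complex.abs_arg_lt_pi_div_two_iff.2 (Or.inl (cuspHalfDisk_re_pos hz))
  have hp := Real.pi_pos
  calc _ < 2 / Real.pi * (Real.pi / 2) := by gcongr
    _ = 1 := by field_simp

theorem cuspStrip_ne_zero {z : ℂ} (hz : z ∈ ball (0 : ℂ) 1) : cuspStrip z ≠ 0 := by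
  intro h
  have := one_lt_cuspStrip_re hz
  rw [h] at this
  simp at this
  linarith

/-- `Re u` grows only logarithmically at `1`, so its cube is dominated by a weak power
singularity. -/
theorem cuspStrip_re_pow_le {z : ℂ} (hz : z ∈ ball (0 : ℂ) 1) :
    (cuspStrip z).re ^ 3 ≤ 13 ^ 3 * 2 * ‖1 - z‖ ^ (-(1 / 4) : ℝ) := by
  have hz1 : ‖z‖ < 1 := by simpa using hz
  have h1z : 0 < ‖1 - z‖ := by
    rw [norm_pos_iff]
    intro h
    rw [← sub_eq_zero.1 h] at hz1
    simp at hz1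
  set y := 8 / ‖1 - z‖ with hy
  have hypos : 0 < y := by positivity
  have hle2 : ‖1 - z‖ ≤ 2 := by
    refine (norm_sub_le _ _).trans ?_
    simp; linarith
  have hy1 : 1 ≤ y := by
    rw [hy, le_div_iff₀ h1z]; linarith
  have hX : (cuspStrip z).re ≤ 1 + Real.log y := by
    rw [cuspStrip_re]
    have h := Real.log_le_log (by positivity) (norm_one_sub_le_cuspHalfDisk hz)
    have hyl : Real.log (‖1 - z‖ / 8) = -Real.log y := by
      rw [← Real.log_inv, hy, inv_div]
    rw [hyl] at h
    have hlog := Real.log_nonneg hy1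
    have hneg := Real.log_neg (norm_pos_iff.2 (cuspHalfDisk_ne_zero hz))
      (norm_cuspHalfDisk_lt_one hz)
    have hp : 2 / Real.pi ≤ 1 := by
      rw [div_le_one Real.pi_pos]; exact Real.two_le_pi
    have hp0 : 0 < 2 / Real.pi := by positivity
    nlinarith
  have hlog : Real.log y ≤ y ^ (1 / 12 : ℝ) / (1 / 12) :=
    Real.log_le_rpow_div hypos.le (by norm_num)
  have h1y : 1 ≤ y ^ (1 / 12 : ℝ) := Real.one_le_rpow hy1 (by norm_num)
  have hX2 : (cuspStrip z).re ≤ 13 * y ^ (1 / 12 : ℝ) := by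
    rw [div_eq_mul_inv] at hlog
    norm_num at hlog
    norm_num
    norm_num at h1y
    linarith
  have hX0 := one_lt_cuspStrip_re hz
  calc (cuspStrip z).re ^ 3 ≤ (13 * y ^ (1 / 12 : ℝ)) ^ 3 := by gcongr
    _ = 13 ^ 3 * y ^ (1 / 4 : ℝ) := by
      rw [mul_pow, ← Real.rpow_natCast (y ^ _), ← Real.rpow_mul hypos.le]
      norm_num
    _ = 13 ^ 3 * ((8 : ℝ) ^ (1 / 4 : ℝ) * ‖1 - z‖ ^ (-(1 / 4) : ℝ)) := by
      rw [hy, div_eq_mul_inv, Real.mul_rpow (by norm_num) (by positivity),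
        Real.inv_rpow h1z.le, Real.rpow_neg h1z.le]
    _ ≤ 13 ^ 3 * 2 * ‖1 - z‖ ^ (-(1 / 4) : ℝ) := by
      have h8 : (8 : ℝ) ^ (1 / 4 : ℝ) ≤ 2 := by
        calc (8 : ℝ) ^ (1 / 4 : ℝ) ≤ 16 ^ (1 / 4 : ℝ) :=
              Real.rpow_le_rpow (by norm_num) (by norm_num) (by norm_num)
          _ = 2 := by
            rw [show (16 : ℝ) = 2 ^ (4 : ℝ) by norm_num, ← Real.rpow_mul (by norm_num)]
            norm_num
      rw [mul_assoc]
      gcongr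

/-! ### Boundary values of the cusp map -/

/-- The principal square root extends continuously from the closed upper half-plane to every point of
it, including the cut. -/
theorem tendsto_cpow_half {w : ℂ} (hw : 0 ≤ w.im) :
    ∃ s : ℂ, Tendsto (fun v : ℂ => v ^ (1 / 2 : ℂ)) (𝓝[{v | 0 ≤ v.im}] w) (𝓝 s) := by
  by_cases h : w ∈ Complex.slitPlane
  · exact ⟨_, (continuousAt_id.cpow continuousAt_const h).tendsto.mono_left nhdsWithin_le_nhds⟩
  rcases eq_or_ne w 0 with rfl | h0
  · refine ⟨0, tendsto_zero_iff_norm_tendsto_zero.2 ?_⟩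
    have hn : (fun v : ℂ => ‖v ^ (1 / 2 : ℂ)‖) = fun v : ℂ => Real.sqrt ‖v‖ := by
      funext v
      rw [← cpow_half_sq v, norm_pow, Real.sqrt_sq (norm_nonneg _), cpow_half_sq]
    rw [hn]
    have : Continuous fun v : ℂ => Real.sqrt ‖v‖ := by fun_prop
    simpa using (this.tendsto 0).mono_left nhdsWithin_le_nhds
  · have him : w.im = 0 := by
      by_contra h1
      exact h (Or.inr h1)
    have hre : w.re < 0 := by
      refine lt_of_le_of_ne (not_lt.1 fun h1 => h (Or.inl h1)) fun h1 => h0 ?_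
      exact Complex.ext h1 him
    have hl := (Complex.continuousWithinAt_log_of_re_neg_of_im_zero hre him).tendsto
    refine ⟨_, Tendsto.congr' ?_ ((hl.mul_const (1 / 2 : ℂ)).cexp)⟩
    filter_upwards [mem_nhdsWithin_of_mem_nhds (isOpen_ne.mem_nhds h0)] with v hv
    rw [Complex.cpow_def_of_ne_zero hv]

theorem mem_closure_ball {x : ℂ} (hx : x ∈ closedBall (0 : ℂ) 1) : x ∈ closure (ball (0 : ℂ) 1) := by
  rwa [closure_ball _ one_ne_zero]

theorem tendsto_cuspHalfDisk {x : ℂ} (hx : x ∈ closedBall (0 : ℂ) 1) :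
    ∃ y, Tendsto cuspHalfDisk (𝓝[ball 0 1] x) (𝓝 y) := by
  rcases eq_or_ne x (-Complex.I) with rfl | h
  · -- here `w` and `s` tend to infinity, and `χ₀ = i + 2 / (s + i)`
    refine ⟨Complex.I, ?_⟩
    have hnum : Tendsto (fun z : ℂ => ‖z - Complex.I‖) (𝓝[ball 0 1] (-Complex.I)) (𝓝 2) := by
      have : Continuous fun z : ℂ => ‖z - Complex.I‖ := by fun_prop
      have h2 := (this.tendsto (-Complex.I)).mono_left (nhdsWithin_le_nhds (s := ball 0 1))
      have e : ‖-Complex.I - Complex.I‖ = 2 := by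
        rw [show -Complex.I - Complex.I = -(2 * Complex.I) by ring]; simp
      rwa [e] at h2
    have hden : Tendsto (fun z : ℂ => ‖Complex.I * z - 1‖) (𝓝[ball 0 1] (-Complex.I)) (𝓝[>] 0) := by
      refine tendsto_nhdsWithin_iff.2 ⟨?_, ?_⟩
      · have : Continuous fun z : ℂ => ‖Complex.I * z - 1‖ := by fun_prop
        have h2 := (this.tendsto (-Complex.I)).mono_left (nhdsWithin_le_nhds (s := ball 0 1))
        simpa using h2
      · filter_upwards [self_mem_nhdsWithin] with z hz
        exact norm_pos_iff.2 (I_mul_sub_one_ne_zero (ne_neg_I_of_mem_ball hz))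
    have hw : Tendsto (fun z : ℂ => ‖cuspHalfPlane z‖) (𝓝[ball 0 1] (-Complex.I)) atTop := by
      have := hnum.pos_mul_atTop two_pos (tendsto_inv_nhdsGT_zero.comp hden)
      refine this.congr fun z => ?_
      simp [cuspHalfPlane, div_eq_mul_inv]
    have hs : Tendsto (fun z : ℂ => ‖cuspQuadrant z‖) (𝓝[ball 0 1] (-Complex.I)) atTop := by
      refine (Real.tendsto_sqrt_atTop.comp hw).congr fun z => ?_
      rw [Function.comp_apply, ← cuspQuadrant_sq, norm_pow, Real.sqrt_sq (norm_nonneg _)]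
    have hs' : Tendsto (fun z : ℂ => (cuspQuadrant z + Complex.I)⁻¹)
        (𝓝[ball 0 1] (-Complex.I)) (𝓝 0) := by
      refine tendsto_inv₀_cobounded.comp ?_
      refine tendsto_norm_atTop_iff_cobounded.1 (tendsto_atTop_mono (fun z => ?_)
        (tendsto_atTop_add_const_right _ (-1) hs))
      have := norm_sub_norm_le (cuspQuadrant z) (-Complex.I)
      simp at this
      linarith
    have := ((hs'.const_mul 2).const_add Complex.I)
    rw [mul_zero, add_zero] at this
    refine this.congr' ?_
    filter_upwards [self_mem_nhdsWithin] with z hz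
    have h0 := add_I_ne_zero (cuspQuadrant_re_im hz).2.le
    rw [cuspHalfDisk_eq]
    field_simp
    linear_combination 2 * Complex.I_mul_I
  · have hd := I_mul_sub_one_ne_zero h
    have hx1 : ‖x‖ ≤ 1 := by simpa using hx
    have hc : ContinuousAt cuspHalfPlane x := by
      unfold cuspHalfPlane
      exact ContinuousAt.div (by fun_prop) (by fun_prop) hd
    have him : 0 ≤ (cuspHalfPlane x).im := by
      rw [cuspHalfPlane_im]
      exact div_nonneg (by nlinarith [norm_nonneg x]) (Complex.normSq_nonneg _)
    obtain ⟨s, hs⟩ := tendsto_cpow_half him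
    have hs2 : Tendsto cuspQuadrant (𝓝[ball 0 1] x) (𝓝 s) := by
      refine hs.comp (tendsto_nhdsWithin_iff.2 ⟨hc.tendsto.mono_left nhdsWithin_le_nhds, ?_⟩)
      filter_upwards [self_mem_nhdsWithin] with z hz
      exact (cuspHalfPlane_im_pos hz).le
    have hne : (𝓝[ball (0 : ℂ) 1] x).NeBot := mem_closure_iff_nhdsWithin_neBot.1 (mem_closure_ball hx)
    have hsim : 0 ≤ s.im := by
      refine ge_of_tendsto ((Complex.continuous_im.tendsto s).comp hs2) ?_
      filter_upwards [self_mem_nhdsWithin] with z hz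
      exact (cuspQuadrant_re_im hz).2.le
    refine ⟨Complex.I * (s - Complex.I) / (s + Complex.I), ?_⟩
    have := ((hs2.sub_const Complex.I).const_mul Complex.I).div (hs2.add_const Complex.I)
      (add_I_ne_zero hsim)
    exact this.congr fun z => (cuspHalfDisk_eq z).symm

theorem tendsto_cuspHalfDisk_one : Tendsto cuspHalfDisk (𝓝[ball 0 1] 1) (𝓝 0) := by
  have hone : (1 : ℂ) ≠ -Complex.I := by
    intro h
    have := congrArg Complex.re h
    simp at this
  have hd := I_mul_sub_one_ne_zero hone
  have hc : ContinuousAt (fun z : ℂ => (1 + Complex.I) * (z - 1) / (Complex.I * z - 1)) 1 :=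
    ContinuousAt.div (by fun_prop) (by fun_prop) hd
  have ht : Tendsto (fun z : ℂ => ‖(1 + Complex.I) * (z - 1) / (Complex.I * z - 1)‖)
      (𝓝[ball 0 1] 1) (𝓝 0) := by
    have := (hc.norm).tendsto.mono_left (nhdsWithin_le_nhds (s := ball 0 1))
    simpa only [sub_self, mul_zero, zero_div, norm_zero] using this
  refine squeeze_zero_norm' ?_ ht
  filter_upwards [self_mem_nhdsWithin] with z hz
  rw [norm_cuspHalfDisk_eq hz, ← cuspHalfPlane_add_one (ne_neg_I_of_mem_ball hz)]
  refine div_le_self (norm_nonneg _) (one_le_pow₀ ?_)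
  have h1 := Complex.im_le_norm (cuspQuadrant z + Complex.I)
  have h2 := (cuspQuadrant_re_im hz).2
  simp at h1
  linarith

theorem tendsto_cuspFormula_one : Tendsto cuspFormula (𝓝[ball 0 1] 1) (𝓝 1) := by
  have h1 : Tendsto (fun z => ‖cuspHalfDisk z‖) (𝓝[ball 0 1] 1) (𝓝[>] 0) := by
    refine tendsto_nhdsWithin_iff.2 ⟨tendsto_zero_iff_norm_tendsto_zero.1 tendsto_cuspHalfDisk_one, ?_⟩
    filter_upwards [self_mem_nhdsWithin] with z hz
    exact norm_pos_iff.2 (cuspHalfDisk_ne_zero hz)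
  have h2 : Tendsto (fun z => (cuspStrip z).re) (𝓝[ball 0 1] 1) atTop := by
    have h3 := (Real.tendsto_log_nhdsGT_zero.comp h1).const_mul_atBot
      (show 0 < 2 / Real.pi by positivity)
    have h4 := tendsto_atTop_add_const_left _ 1 (tendsto_neg_atBot_atTop.comp h3)
    refine h4.congr fun z => ?_
    rw [cuspStrip_re]
    simp [sub_eq_add_neg]
  have h3 : Tendsto (fun z => (cuspStrip z)⁻¹) (𝓝[ball 0 1] 1) (𝓝 0) := by
    refine tendsto_inv₀_cobounded.comp (tendsto_norm_atTop_iff_cobounded.1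
      (tendsto_atTop_mono (fun z => Complex.re_le_norm _) h2))
  have := h3.const_sub 1
  rw [sub_zero] at this
  refine this.congr fun z => ?_
  rw [cuspFormula_eq, one_div]

theorem tendsto_cuspFormula {x : ℂ} (hx : x ∈ closedBall (0 : ℂ) 1) :
    ∃ y, Tendsto cuspFormula (𝓝[ball 0 1] x) (𝓝 y) := by
  rcases eq_or_ne x 1 with rfl | h1
  · exact ⟨1, tendsto_cuspFormula_one⟩
  obtain ⟨y, hy⟩ := tendsto_cuspHalfDisk hx
  have hne : (𝓝[ball (0 : ℂ) 1] x).NeBot := mem_closure_iff_nhdsWithin_neBot.1 (mem_closure_ball hx)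
  have hre : 0 ≤ y.re := by
    refine ge_of_tendsto ((Complex.continuous_re.tendsto y).comp hy) ?_
    filter_upwards [self_mem_nhdsWithin] with z hz
    exact (cuspHalfDisk_re_pos hz).le
  have hy0 : ‖1 - x‖ / 8 ≤ ‖y‖ := by
    have hc : Continuous fun z : ℂ => ‖1 - z‖ / 8 := by fun_prop
    refine le_of_tendsto_of_tendsto ((hc.tendsto x).mono_left nhdsWithin_le_nhds) hy.norm ?_
    filter_upwards [self_mem_nhdsWithin] with z hz
    exact norm_one_sub_le_cuspHalfDisk hz
  have hypos : y ≠ 0 := by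
    rw [← norm_pos_iff]
    have := norm_pos_iff.2 (sub_ne_zero.2 h1.symm)
    linarith
  have hslit : y ∈ Complex.slitPlane := by
    rcases hre.lt_or_eq with h | h
    · exact Or.inl h
    · refine Or.inr fun h' => hypos (Complex.ext h.symm h')
  have hu : Tendsto cuspStrip (𝓝[ball 0 1] x) (𝓝 (-(2 / (Real.pi : ℂ)) * Complex.log y + 1)) :=
    ((hy.clog hslit).const_mul _).add_const 1
  have hu0 : -(2 / (Real.pi : ℂ)) * Complex.log y + 1 ≠ 0 := by
    have hre : 1 ≤ (-(2 / (Real.pi : ℂ)) * Complex.log y + 1).re := by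
      refine ge_of_tendsto ((Complex.continuous_re.tendsto _).comp hu) ?_
      filter_upwards [self_mem_nhdsWithin] with z hz
      exact (one_lt_cuspStrip_re hz).le
    intro h
    rw [h] at hre
    simp at hre
    linarith
  exact ⟨_, (tendsto_const_nhds.div hu hu0).const_sub 1⟩

theorem continuousOn_cuspMap : ContinuousOn cuspMap (closedBall 0 1) :=
  continuousOn_extendFrom (fun _ hx => mem_closure_ball hx) fun _ hx => tendsto_cuspFormula hx

theorem cuspMap_one : cuspMap 1 = 1 :=
  extendFrom_eq (mem_closure_ball (by simp)) tendsto_cuspFormula_one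

theorem differentiableOn_cuspFormula : DifferentiableOn ℂ cuspFormula (ball 0 1) := by
  intro z hz
  refine DifferentiableAt.differentiableWithinAt ?_
  have h1 : DifferentiableAt ℂ cuspHalfPlane z := by
    unfold cuspHalfPlane
    exact DifferentiableAt.div (by fun_prop) (by fun_prop)
      (I_mul_sub_one_ne_zero (ne_neg_I_of_mem_ball hz))
  have h2 : DifferentiableAt ℂ cuspQuadrant z :=
    h1.cpow_const (Or.inr (cuspHalfPlane_im_pos hz).ne')
  have h3 : DifferentiableAt ℂ cuspHalfDisk z := by
    rw [funext cuspHalfDisk_eq]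
    exact DifferentiableAt.div (by fun_prop) (by fun_prop)
      (add_I_ne_zero (cuspQuadrant_re_im hz).2.le)
  have h4 : DifferentiableAt ℂ cuspStrip z :=
    ((h3.clog (Or.inl (cuspHalfDisk_re_pos hz))).const_mul _).add_const _
  rw [funext cuspFormula_eq]
  exact ((differentiableAt_const _).div h4 (cuspStrip_ne_zero hz)).const_sub _

theorem cuspMap_eq {z : ℂ} (hz : z ∈ ball (0 : ℂ) 1) : cuspMap z = 1 - 1 / cuspStrip z := by
  rw [cuspMap, extendFrom_extends differentiableOn_cuspFormula.continuousOn z hz, cuspFormula_eq]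

theorem differentiableOn_cuspMap : DifferentiableOn ℂ cuspMap (ball 0 1) :=
  differentiableOn_cuspFormula.congr fun _ hz => cuspMap_eq hz

/-- The half-strip lies well inside the half-plane `Re u > 1/2`, so `1 - |χ|` is comparable to
`1 / Re u`. -/
theorem one_sub_norm_cuspMap_ge {z : ℂ} (hz : z ∈ ball (0 : ℂ) 1) :
    1 / (4 * (cuspStrip z).re) ≤ 1 - ‖cuspMap z‖ := by
  have hX := one_lt_cuspStrip_re hz
  have hY := (abs_lt.1 (abs_cuspStrip_im_lt hz))
  have h0 := cuspStrip_ne_zero hz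
  rw [cuspMap_eq hz]
  set u := cuspStrip z
  have hn : ‖u‖ ^ 2 = u.re ^ 2 + u.im ^ 2 := by
    rw [← Complex.normSq_eq_norm_sq, Complex.normSq_apply]; ring
  have h1 : ‖1 - 1 / u‖ ^ 2 * ‖u‖ ^ 2 = ‖u‖ ^ 2 - (2 * u.re - 1) := by
    rw [← mul_pow, ← norm_mul, sub_mul, one_mul, one_div, inv_mul_cancel₀ h0, hn,
      ← Complex.normSq_eq_norm_sq, Complex.normSq_apply]
    simp
    ring
  have hu2 : ‖u‖ ^ 2 ≤ 2 * u.re ^ 2 := by rw [hn]; nlinarith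
  have hupos : 0 < ‖u‖ ^ 2 := by positivity
  set t := ‖1 - 1 / u‖
  have ht0 : 0 ≤ t := norm_nonneg _
  have h2 : (1 - t ^ 2) * ‖u‖ ^ 2 = 2 * u.re - 1 := by linarith
  have h3 : 0 < 1 - t ^ 2 := by
    by_contra h
    push Not at h
    nlinarith
  have ht1 : t < 1 := by nlinarith
  rw [div_le_iff₀ (by positivity)]
  have h4 : (2 * u.re - 1) ≤ (1 - t ^ 2) * (2 * u.re ^ 2) := by
    rw [← h2]; gcongr
  have h5 : u.re ≤ (1 - t ^ 2) * (2 * u.re ^ 2) := by linarith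
  have h6 : 1 ≤ (1 - t ^ 2) * (2 * u.re) := by
    by_contra h
    push Not at h
    nlinarith
  have h7 : (1 - t ^ 2) ≤ 2 * (1 - t) := by nlinarith
  nlinarith

theorem one_sub_norm_cuspMap_le {z : ℂ} (hz : z ∈ ball (0 : ℂ) 1) :
    1 - ‖cuspMap z‖ ≤ 1 / (cuspStrip z).re := by
  have hX := one_lt_cuspStrip_re hz
  have h1 := norm_sub_norm_le (1 : ℂ) (cuspMap z)
  rw [norm_one] at h1
  refine h1.trans ?_
  rw [cuspMap_eq hz, sub_sub_cancel, norm_div, norm_one]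
  exact one_div_le_one_div_of_le (by linarith) (Complex.re_le_norm _)

theorem norm_cuspMap_lt_one {z : ℂ} (hz : z ∈ ball (0 : ℂ) 1) : ‖cuspMap z‖ < 1 := by
  have := one_sub_norm_cuspMap_ge hz
  have h2 := one_lt_cuspStrip_re hz
  have : 0 < 1 / (4 * (cuspStrip z).re) := by positivity
  linarith

theorem norm_cuspMap_le_one {z : ℂ} (hz : z ∈ closedBall (0 : ℂ) 1) : ‖cuspMap z‖ ≤ 1 := by
  have : MapsTo cuspMap (closure (ball 0 1)) (closure (ball 0 1)) :=
    MapsTo.closure_of_continuousOn (fun x hx => by simpa using norm_cuspMap_lt_one hx)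
      (by rw [closure_ball _ one_ne_zero]; exact continuousOn_cuspMap)
  have h := this (mem_closure_ball hz)
  rw [closure_ball _ one_ne_zero] at h
  simpa using h

/-- If `χ` were constant, it would equal its boundary value `1`, which is not in the disk. -/
theorem exists_deriv_cuspMap_ne_zero : ∃ z ∈ ball (0 : ℂ) 1, deriv cuspMap z ≠ 0 := by
  by_contra! h
  obtain ⟨a, ha⟩ : ∃ a, ∀ z ∈ ball (0 : ℂ) 1, cuspMap z = a :=
    isOpen_ball.exists_is_const_of_deriv_eq_zero (convex_ball _ _).isPreconnected
      differentiableOn_cuspMap h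
  have hne : (𝓝[ball (0 : ℂ) 1] 1).NeBot :=
    mem_closure_iff_nhdsWithin_neBot.1 (mem_closure_ball (by simp))
  have h1 : Tendsto cuspMap (𝓝[ball 0 1] 1) (𝓝 1) := by
    have := (continuousOn_cuspMap 1 (by simp)).mono_left (nhdsWithin_mono _ ball_subset_closedBall)
    rwa [cuspMap_one] at this
  have h2 : Tendsto cuspMap (𝓝[ball 0 1] 1) (𝓝 a) := by
    refine tendsto_const_nhds.congr' ?_
    filter_upwards [self_mem_nhdsWithin] with z hz
    exact (ha z hz).symm
  have h3 := tendsto_nhds_unique h1 h2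
  have h4 := norm_cuspMap_lt_one (z := 0) (by simp)
  rw [ha 0 (by simp), ← h3] at h4
  simp at h4

/-! ### The function `φ` and the smallness condition -/

theorem cos_half_pi_mul_pos {θ : ℝ} (hθ0 : 0 < θ) (hθ1 : θ < 1) : 0 < Real.cos (θ * (Real.pi / 2)) := by
  have hp := Real.pi_pos
  exact Real.cos_pos_of_mem_Ioo ⟨by nlinarith, by nlinarith⟩

/-- For `θ < 1` the power `(1 - z)^{-θ}` stays in a sector strictly inside the right half-plane. -/
theorem norm_phi_le {θ : ℝ} (hθ0 : 0 < θ) (hθ1 : θ < 1) {z : ℂ} (hz : 0 ≤ (1 - z).re) (hz1 : z ≠ 1) :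
    ‖phi θ z‖ ≤ Real.exp (-(Real.cos (θ * (Real.pi / 2)) * ‖1 - z‖ ^ (-θ))) := by
  have h0 : 1 - z ≠ 0 := sub_ne_zero.2 hz1.symm
  have hpos : 0 < ‖1 - z‖ := norm_pos_iff.2 h0
  rw [phi, if_neg hz1, Complex.norm_exp]
  refine Real.exp_le_exp.2 ?_
  rw [Complex.neg_re, neg_le_neg_iff, Complex.cpow_def_of_ne_zero h0, Complex.exp_re,
    Real.rpow_def_of_pos hpos, show -(θ : ℂ) = ((-θ : ℝ) : ℂ) by push_cast; rfl,
    Complex.re_mul_ofReal, Complex.im_mul_ofReal, Complex.log_re, Complex.log_im, mul_comm]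
  refine mul_le_mul_of_nonneg_left ?_ (Real.exp_pos _).le
  have harg : |(1 - z).arg| ≤ Real.pi / 2 := Complex.abs_arg_le_pi_div_two_iff.2 hz
  rw [← Real.cos_abs ((1 - z).arg * -θ), abs_mul, abs_neg, abs_of_pos hθ0]
  have hp := Real.pi_pos
  refine Real.cos_le_cos_of_nonneg_of_le_pi (by positivity) (by nlinarith) ?_
  rw [mul_comm]
  gcongr

theorem differentiableOn_phi (θ : ℝ) : DifferentiableOn ℂ (phi θ) (ball 0 1) := by
  have h1 : ∀ z ∈ ball (0 : ℂ) 1, z ≠ 1 := by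
    rintro z hz rfl
    simp at hz
  have : DifferentiableOn ℂ (fun z : ℂ => Complex.exp (-((1 - z) ^ (-(θ : ℂ))))) (ball 0 1) := by
    intro z hz
    refine DifferentiableAt.differentiableWithinAt ?_
    have hs : 1 - z ∈ Complex.slitPlane := by
      refine Or.inl ?_
      have : z.re ≤ ‖z‖ := Complex.re_le_norm z
      have hz' : ‖z‖ < 1 := by simpa using hz
      simp
      linarith
    have hd : DifferentiableAt ℂ (fun w : ℂ => 1 - w) z := by fun_prop
    exact ((hd.cpow_const hs).neg).cexp
  exact this.congr fun z hz => by rw [phi, if_neg (h1 z hz)]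

theorem one_sub_re_nonneg {z : ℂ} (hz : z ∈ closedBall (0 : ℂ) 1) : 0 ≤ (1 - z).re := by
  have : z.re ≤ ‖z‖ := Complex.re_le_norm z
  have hz' : ‖z‖ ≤ 1 := by simpa using hz
  simp
  linarith

theorem one_sub_re_pos {z : ℂ} (hz : z ∈ closedBall (0 : ℂ) 1) (h1 : z ≠ 1) : 0 < (1 - z).re := by
  refine lt_of_le_of_ne (one_sub_re_nonneg hz) fun h => h1 ?_
  have hz' : ‖z‖ ≤ 1 := by simpa using hz
  have hre : z.re = 1 := by simp at h; linarith
  have h2 : z.re ^ 2 + z.im ^ 2 ≤ 1 := by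
    have := Complex.normSq_eq_norm_sq z
    rw [Complex.normSq_apply] at this
    nlinarith [norm_nonneg z]
  refine Complex.ext hre ?_
  have : z.im ^ 2 ≤ 0 := by rw [hre] at h2; linarith
  simpa using this

theorem continuousOn_phi {θ : ℝ} (hθ0 : 0 < θ) (hθ1 : θ < 1) :
    ContinuousOn (phi θ) (closedBall 0 1) := by
  intro z hz
  rcases eq_or_ne z 1 with rfl | h1
  · have hγ := cos_half_pi_mul_pos hθ0 hθ1
    rw [← continuousWithinAt_sdiff_singleton, ContinuousWithinAt, show phi θ 1 = 0 by simp [phi]]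
    have ht : Tendsto (fun w : ℂ => ‖1 - w‖) (𝓝[closedBall (0 : ℂ) 1 \ {1}] 1) (𝓝[>] 0) := by
      refine tendsto_nhdsWithin_iff.2 ⟨?_, ?_⟩
      · have : Continuous fun w : ℂ => ‖1 - w‖ := by fun_prop
        simpa using (this.tendsto 1).mono_left (nhdsWithin_le_nhds (s := closedBall (0 : ℂ) 1 \ {1}))
      · filter_upwards [self_mem_nhdsWithin] with w hw
        exact norm_pos_iff.2 (sub_ne_zero.2 fun h => hw.2 h.symm)
    have ht2 : Tendsto (fun w : ℂ => Real.exp (-(Real.cos (θ * (Real.pi / 2)) * ‖1 - w‖ ^ (-θ))))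
        (𝓝[closedBall (0 : ℂ) 1 \ {1}] 1) (𝓝 0) :=
      Real.tendsto_exp_neg_atTop_nhds_zero.comp
        (((tendsto_rpow_neg_nhdsGT_zero (by linarith : -θ < 0)).comp ht).const_mul_atTop hγ)
    refine squeeze_zero_norm' ?_ ht2
    filter_upwards [self_mem_nhdsWithin] with w hw
    exact norm_phi_le hθ0 hθ1 (one_sub_re_nonneg hw.1) hw.2
  · have hs : 1 - z ∈ Complex.slitPlane := Or.inl (one_sub_re_pos hz h1)
    have hc : ContinuousAt (fun z : ℂ => Complex.exp (-((1 - z) ^ (-(θ : ℂ))))) z :=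
      (((continuousAt_const.sub continuousAt_id).cpow continuousAt_const hs).neg).cexp
    refine (hc.congr ?_).continuousWithinAt
    filter_upwards [isOpen_ne.mem_nhds h1] with w hw
    rw [phi, if_neg hw]

theorem norm_phi_cuspMap_le {θ : ℝ} (hθ0 : 0 < θ) (hθ1 : θ < 1) {z : ℂ} (hz : z ∈ ball (0 : ℂ) 1) :
    ‖phi θ (cuspMap z)‖ ≤ Real.exp (-(Real.cos (θ * (Real.pi / 2)) * (cuspStrip z).re ^ θ)) := by
  have hb := norm_cuspMap_lt_one hz
  have hX := one_lt_cuspStrip_re hz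
  have hγ := cos_half_pi_mul_pos hθ0 hθ1
  have hb' : cuspMap z ∈ closedBall (0 : ℂ) 1 := by simpa using hb.le
  refine (norm_phi_le hθ0 hθ1 (one_sub_re_nonneg hb') ?_).trans ?_
  · intro h; rw [h] at hb; simp at hb
  · have e : ‖1 - cuspMap z‖ ^ (-θ) = ‖cuspStrip z‖ ^ θ := by
      rw [cuspMap_eq hz, sub_sub_cancel, norm_div, norm_one, one_div, Real.inv_rpow (norm_nonneg _),
        Real.rpow_neg (norm_nonneg _), inv_inv]
    rw [e, Real.exp_le_exp, neg_le_neg_iff]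
    have := Complex.re_le_norm (cuspStrip z)
    gcongr

theorem tendsto_mul_exp_neg_rpow {θ b : ℝ} (hθ0 : 0 < θ) (hb : 0 < b) :
    Tendsto (fun X : ℝ => X * Real.exp (-(b * X ^ θ))) atTop (𝓝 0) := by
  have h := (tendsto_rpow_mul_exp_neg_mul_atTop_nhds_zero (1 / θ) b hb).comp
    (tendsto_rpow_atTop hθ0)
  refine h.congr' ?_
  filter_upwards [eventually_ge_atTop 0] with X hX
  rw [Function.comp_apply, ← Real.rpow_mul hX, mul_one_div_cancel hθ0.ne', Real.rpow_one, neg_mul]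

theorem exists_cuspAdmissible {θ : ℝ} (hθ0 : 0 < θ) (hθ1 : θ < 1) :
    ∃ c₀ : ℝ, 0 < c₀ ∧ c₀ ≤ 1 ∧ ∀ c : ℝ, 0 < c → c < c₀ → CuspAdmissible θ c := by
  have hγ := cos_half_pi_mul_pos hθ0 hθ1
  set γ := Real.cos (θ * (Real.pi / 2))
  obtain ⟨R, hR⟩ := eventually_atTop.1
    ((tendsto_mul_exp_neg_rpow hθ0 hγ).eventually (eventually_le_nhds zero_lt_one))
  have hD : ∀ X : ℝ, 1 < X → X * Real.exp (-(γ * X ^ θ)) ≤ max R 1 := by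
    intro X hX
    rcases le_total R X with h | h
    · exact (hR X h).trans (le_max_right _ _)
    · have : Real.exp (-(γ * X ^ θ)) ≤ 1 := Real.exp_le_one_iff.2 (by
        have := Real.rpow_nonneg (by linarith : 0 ≤ X) θ
        nlinarith)
      refine le_trans ?_ (h.trans (le_max_left _ _))
      nlinarith
  have hm : 1 ≤ max R 1 := le_max_right _ _
  have hm0 : 0 < max R 1 := by linarith
  refine ⟨1 / (8 * max R 1), by positivity, ?_, fun c hc hc0 z hz => ?_⟩
  · rw [div_le_one (by positivity)]; linarith
  · have hX := one_lt_cuspStrip_re hz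
    have h1 := one_sub_norm_cuspMap_ge hz
    have h2 := norm_phi_cuspMap_le hθ0 hθ1 hz
    have h3 := hD _ hX
    set X := (cuspStrip z).re
    have h4 : 2 * c * ‖phi θ (cuspMap z)‖ < 1 / (4 * X) := by
      rw [lt_div_iff₀ (by positivity)]
      rw [lt_div_iff₀ (by positivity)] at hc0
      calc 2 * c * ‖phi θ (cuspMap z)‖ * (4 * X)
          = 8 * c * (X * ‖phi θ (cuspMap z)‖) := by ring
        _ ≤ 8 * c * max R 1 := by
          gcongr
          refine le_trans ?_ h3
          gcongr
        _ < 1 := by linarith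
    linarith

/-- Admissibility leaves room for an exponential weight in `(Re u)^θ`. -/
theorem exists_weight {θ c : ℝ} (hθ0 : 0 < θ) (hθ1 : θ < 1) (hc1 : c < 1)
    (hc : CuspAdmissible θ c) : ∃ δ : ℝ, 0 < δ ∧ ∀ z ∈ ball (0 : ℂ) 1,
      c * ‖phi θ (cuspMap z)‖ * Real.exp (δ * (cuspStrip z).re ^ θ) ≤
        3 / 5 * (1 - ‖cuspMap z‖) := by
  have hγ := cos_half_pi_mul_pos hθ0 hθ1
  set γ := Real.cos (θ * (Real.pi / 2)) with hγdef
  obtain ⟨R, hR⟩ := eventually_atTop.1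
    ((tendsto_mul_exp_neg_rpow hθ0 (half_pos hγ)).eventually
      (eventually_le_nhds (show (0 : ℝ) < 3 / 20 by norm_num)))
  set R' := max R 1
  have hR'1 : 1 ≤ R' := le_max_right _ _
  have hR'θ : 0 < R' ^ θ := Real.rpow_pos_of_pos (by linarith) _
  -- for `X ≥ R'` the decay of `φ` beats the weight; for `X ≤ R'` the weight is at most `6/5`, which
  -- turns the constant `1/2` of admissibility into `3/5`
  have hlog : 0 < Real.log (6 / 5) := Real.log_pos (by norm_num)
  refine ⟨min (γ / 2) (Real.log (6 / 5) / R' ^ θ), by positivity, fun z hz => ?_⟩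
  set δ := min (γ / 2) (Real.log (6 / 5) / R' ^ θ)
  have hδ0 : 0 < δ := by positivity
  have hX := one_lt_cuspStrip_re hz
  have h1 := one_sub_norm_cuspMap_ge hz
  have h2 := norm_phi_cuspMap_le hθ0 hθ1 hz
  have hadm := hc z hz
  set X := (cuspStrip z).re
  have hXθ : 0 < X ^ θ := Real.rpow_pos_of_pos (by linarith) _
  rcases le_total R' X with h | h
  · calc c * ‖phi θ (cuspMap z)‖ * Real.exp (δ * X ^ θ)
        ≤ 1 * Real.exp (-(γ * X ^ θ)) * Real.exp (γ / 2 * X ^ θ) := by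
          gcongr
          exact min_le_left _ _
      _ = Real.exp (-(γ / 2 * X ^ θ)) := by
          rw [one_mul, ← Real.exp_add]
          congr 1; ring
      _ ≤ 3 / 5 * (1 / (4 * X)) := by
          have := hR X ((le_max_left _ _).trans h)
          rw [mul_one_div, le_div_iff₀ (by positivity)]
          linarith
      _ ≤ _ := by gcongr
  · have he : Real.exp (δ * X ^ θ) ≤ 6 / 5 := by
      rw [← Real.le_log_iff_exp_le (by norm_num)]
      calc δ * X ^ θ ≤ Real.log (6 / 5) / R' ^ θ * R' ^ θ := by
            gcongr
            exact min_le_right _ _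
        _ = _ := by field_simp
    have h3 : c * ‖phi θ (cuspMap z)‖ ≤ (1 - ‖cuspMap z‖) / 2 := by linarith
    calc c * ‖phi θ (cuspMap z)‖ * Real.exp (δ * X ^ θ)
        ≤ (1 - ‖cuspMap z‖) / 2 * (6 / 5) := by
          have : 0 ≤ 1 - ‖cuspMap z‖ := by
            have := norm_cuspMap_lt_one hz
            linarith
          gcongr
      _ = _ := by ring

/-! ### Expansion along the diagonal -/

/-- The `k`-th coefficient of the expansion `f(ζ, ζ + h) = ∑ₖ a_k(f)(ζ) hᵏ` in powers of `h`. -/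
def diagCoeff (k : ℕ) (f : HardyBidisk) (ζ : ℂ) : ℂ :=
  ∑' p : ℕ × ℕ, f (p.1, p.2 + k) * (ζ ^ p.1 * (((p.2 + k).choose k : ℂ) * ζ ^ p.2))

/-- The sum of the majorants of the terms of `diagCoeff`, for `|ζ| = r`. -/
theorem hasSum_diag_majorant (k : ℕ) {r : ℝ} (hr0 : 0 ≤ r) (hr1 : r < 1) :
    HasSum (fun p : ℕ × ℕ => r ^ p.1 * (((p.2 + k).choose k : ℝ) * r ^ p.2))
      (1 / (1 - r) ^ (k + 2)) := by
  have hr : ‖r‖ < 1 := by rwa [Real.norm_of_nonneg hr0]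
  have h1 := hasSum_geometric_of_lt_one hr0 hr1
  have h2 := hasSum_choose_mul_geometric_of_norm_lt_one k hr
  have h3 := h1.summable.mul_of_nonneg h2.summable (fun _ => by positivity)
    (fun _ => by positivity)
  have h4 := HasSum.mul (f := fun n : ℕ => r ^ n)
    (g := fun n : ℕ => (((n + k).choose k : ℕ) : ℝ) * r ^ n) h1 h2 h3
  rw [pow_succ' (1 - r) (k + 1), one_div, mul_inv, ← one_div (_ ^ (k + 1))]
  exact h4

theorem norm_diagCoeff_term_le (k : ℕ) (f : HardyBidisk) {ζ : ℂ} {r : ℝ} (hζ : ‖ζ‖ ≤ r)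
    (p : ℕ × ℕ) :
    ‖f (p.1, p.2 + k) * (ζ ^ p.1 * (((p.2 + k).choose k : ℂ) * ζ ^ p.2))‖ ≤
      r ^ p.1 * (((p.2 + k).choose k : ℝ) * r ^ p.2) * ‖f‖ := by
  have hr : 0 ≤ r := (norm_nonneg _).trans hζ
  rw [norm_mul, norm_mul, norm_mul, norm_pow, norm_pow, Complex.norm_natCast, mul_comm]
  gcongr
  exact lp.norm_apply_le_norm (by norm_num) f _

theorem summable_diagCoeff (k : ℕ) (f : HardyBidisk) {ζ : ℂ} (hζ : ‖ζ‖ < 1) :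
    Summable fun p : ℕ × ℕ =>
      f (p.1, p.2 + k) * (ζ ^ p.1 * (((p.2 + k).choose k : ℂ) * ζ ^ p.2)) :=
  Summable.of_norm_bounded ((hasSum_diag_majorant k (norm_nonneg ζ) hζ).summable.mul_right ‖f‖)
    (norm_diagCoeff_term_le k f le_rfl)

theorem norm_diagCoeff_le (k : ℕ) (f : HardyBidisk) {ζ : ℂ} (hζ : ‖ζ‖ < 1) :
    ‖diagCoeff k f ζ‖ ≤ ‖f‖ / (1 - ‖ζ‖) ^ (k + 2) := by
  have := tsum_of_norm_bounded ((hasSum_diag_majorant k (norm_nonneg ζ) hζ).mul_right ‖f‖)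
    (norm_diagCoeff_term_le k f le_rfl)
  rwa [one_div, inv_mul_eq_div] at this

theorem diagCoeff_add (k : ℕ) (f g : HardyBidisk) {ζ : ℂ} (hζ : ‖ζ‖ < 1) :
    diagCoeff k (f + g) ζ = diagCoeff k f ζ + diagCoeff k g ζ := by
  rw [diagCoeff, diagCoeff, diagCoeff,
    ← (summable_diagCoeff k f hζ).tsum_add (summable_diagCoeff k g hζ)]
  refine tsum_congr fun p => ?_
  rw [lp.coeFn_add, Pi.add_apply]
  ring

theorem diagCoeff_smul (k : ℕ) (c : ℂ) (f : HardyBidisk) (ζ : ℂ) :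
    diagCoeff k (c • f) ζ = c * diagCoeff k f ζ := by
  rw [diagCoeff, diagCoeff, ← tsum_mul_left]
  refine tsum_congr fun p => ?_
  rw [lp.coeFn_smul, Pi.smul_apply, smul_eq_mul]
  ring

theorem differentiableOn_diagCoeff (k : ℕ) (f : HardyBidisk) :
    DifferentiableOn ℂ (diagCoeff k f) (ball 0 1) := by
  intro ζ hζ
  have h1 : ‖ζ‖ < 1 := by simpa using hζ
  obtain ⟨r, hr1, hr2⟩ := exists_between h1
  have hr0 : 0 ≤ r := (norm_nonneg _).trans hr1.le
  have : DifferentiableOn ℂ (diagCoeff k f) (ball 0 r) :=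
    Complex.differentiableOn_tsum_of_summable_norm
      ((hasSum_diag_majorant k hr0 hr2).summable.mul_right ‖f‖) (fun p => by fun_prop)
      isOpen_ball fun p w hw =>
        norm_diagCoeff_term_le k f (by simpa using (mem_ball_zero_iff.1 hw).le) p
  exact (this.differentiableAt (isOpen_ball.mem_nhds (by simpa using hr1))).differentiableWithinAt

theorem hasSum_choose_mul_pow {K : Type*} [CommRing K] [TopologicalSpace K] (x y : K) (m : ℕ) :
    HasSum (fun k => (m.choose k : K) * (x ^ (m - k) * y ^ k)) ((x + y) ^ m) := by
  have : (x + y) ^ m = ∑ k ∈ Finset.range (m + 1), (m.choose k : K) * (x ^ (m - k) * y ^ k) := by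
    rw [add_comm, add_pow]
    exact Finset.sum_congr rfl fun k _ => by ring
  rw [this]
  refine hasSum_sum_of_ne_finset_zero fun k hk => ?_
  rw [Nat.choose_eq_zero_of_lt (by simpa using hk)]
  simp

/-- Taylor expansion of `f` in the second variable along the diagonal. -/
theorem eval_eq_tsum_diagCoeff (f : HardyBidisk) {ζ h : ℂ} (hh : ‖ζ‖ + ‖h‖ < 1) :
    f.eval (ζ, ζ + h) = ∑' k, diagCoeff k f ζ * h ^ k := by
  have hζ0 := norm_nonneg ζ
  have hh0 := norm_nonneg h
  have hζ : ‖ζ‖ < 1 := by linarith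
  -- the triple series is absolutely summable because `|ζ| + |h| < 1`
  let U : ℕ × ℕ → ℕ → ℂ := fun p k =>
    f p * (ζ ^ p.1 * ((p.2.choose k : ℂ) * (ζ ^ (p.2 - k) * h ^ k)))
  have hN : Summable fun q : (ℕ × ℕ) × ℕ =>
      ‖f‖ * (‖ζ‖ ^ q.1.1 * ((q.1.2.choose q.2 : ℝ) * (‖ζ‖ ^ (q.1.2 - q.2) * ‖h‖ ^ q.2))) := by
    have hin : ∀ p : ℕ × ℕ, HasSum (fun k =>
        ‖f‖ * (‖ζ‖ ^ p.1 * ((p.2.choose k : ℝ) * (‖ζ‖ ^ (p.2 - k) * ‖h‖ ^ k))))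
        (‖f‖ * (‖ζ‖ ^ p.1 * (‖ζ‖ + ‖h‖) ^ p.2)) := fun p =>
      ((hasSum_choose_mul_pow ‖ζ‖ ‖h‖ p.2).mul_left _).mul_left _
    rw [summable_prod_of_nonneg fun q => by positivity]
    refine ⟨fun p => (hin p).summable, ?_⟩
    simp_rw [fun p => (hin p).tsum_eq]
    refine Summable.mul_left _ ?_
    exact (summable_geometric_of_lt_one hζ0 hζ).mul_of_nonneg
      (summable_geometric_of_lt_one (by positivity) hh) (fun _ => by positivity)
      (fun _ => by positivity)
  have hU : Summable (Function.uncurry U) := by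
    refine Summable.of_norm_bounded hN fun q => ?_
    simp only [U, Function.uncurry, norm_mul, norm_pow, Complex.norm_natCast]
    gcongr
    exact lp.norm_apply_le_norm (by norm_num) f _
  have hrow : ∀ p : ℕ × ℕ, ∑' k, U p k = f p * (ζ ^ p.1 * (ζ + h) ^ p.2) := fun p =>
    (((hasSum_choose_mul_pow ζ h p.2).mul_left (ζ ^ p.1)).mul_left (f p)).tsum_eq
  have hcol : ∀ k, ∑' p, U p k = diagCoeff k f ζ * h ^ k := by
    intro k
    have hinj : Function.Injective fun p : ℕ × ℕ => (p.1, p.2 + k) := by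
      rintro ⟨a, b⟩ ⟨c, d⟩ hab
      simpa using hab
    rw [diagCoeff, ← tsum_mul_right, ← hinj.tsum_eq (f := fun p => U p k)]
    · refine tsum_congr fun p => ?_
      simp only [U, Nat.add_sub_cancel]
      ring
    · intro p hp
      rcases lt_or_ge p.2 k with hlt | hge
      · exact absurd (by simp [U, Nat.choose_eq_zero_of_lt hlt]) hp
      · exact ⟨(p.1, p.2 - k), by simp [Nat.sub_add_cancel hge]⟩
  calc f.eval (ζ, ζ + h) = ∑' p, ∑' k, U p k := tsum_congr fun p => (hrow p).symm
    _ = ∑' k, ∑' p, U p k := (hU.tsum_comm).symm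
    _ = _ := tsum_congr hcol

/-! ### A Schwarz lemma -/

/-- A Schwarz lemma: a function with a zero of order `N` at the centre of a disk is smaller by a
factor `q ^ N` on the concentric disk of ratio `q`. -/
theorem norm_le_of_taylorCoeff_eq_zero {F : ℂ → ℂ} {c : ℂ} {ρ B q : ℝ} (hρ : 0 < ρ)
    (hF : DiffContOnCl ℂ F (ball c ρ)) (hB : ∀ z ∈ sphere c ρ, ‖F z‖ ≤ B) {N : ℕ}
    (hN : ∀ i < N, taylorCoeff F c i = 0) (hq0 : 0 ≤ q) (hq : q < 1) {z : ℂ}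
    (hz : ‖z - c‖ ≤ q * ρ) : ‖F z‖ ≤ B * (q ^ N / (1 - q)) := by
  have hzb : z ∈ ball c ρ := by
    rw [mem_ball_iff_norm]
    nlinarith
  have hs := hasSum_taylorCoeff hF.differentiableOn hzb
  have hs2 := (hasSum_nat_add_iff' N).2 hs
  rw [Finset.sum_eq_zero (fun i hi => by rw [hN i (Finset.mem_range.1 hi), zero_mul]),
    sub_zero] at hs2
  have hg : HasSum (fun i => B * (q ^ N * q ^ i)) (B * (q ^ N / (1 - q))) :=
    ((hasSum_geometric_of_lt_one hq0 hq).mul_left _).mul_left _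
  rw [← hs2.tsum_eq]
  refine tsum_of_norm_bounded hg fun i => ?_
  rw [norm_mul, norm_pow]
  calc ‖taylorCoeff F c (i + N)‖ * ‖z - c‖ ^ (i + N)
      ≤ B / ρ ^ (i + N) * (q * ρ) ^ (i + N) := by
        have h := norm_taylorCoeff_le hρ hF hB (i + N)
        exact mul_le_mul h (pow_le_pow_left₀ (norm_nonneg _) hz _) (by positivity)
          ((norm_nonneg _).trans h)
    _ = B * (q ^ N * q ^ i) := by
        rw [mul_pow]
        field_simp
        ring

/-! ### Zero conditions and the size of `f ∘ Φ` -/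

/-- The part of the half-strip with `2ʲ ≤ Re u < 2ʲ⁺¹` corresponds to a piece of `χ(𝔻)` that lies
in a compact part of the disk with centre `1 - 2⁻ʲ` and radius `2⁻ʲ`: with `x = 2ʲ` the distance to
the centre is at most `(√3 / 2) / x`, and `√3 / 2 < 7 / 8 = (14 / 15) * (15 / 16)`. -/
theorem norm_cuspMap_sub_center_le {z : ℂ} (hz : z ∈ ball (0 : ℂ) 1) {x : ℝ} (hx : 1 ≤ x)
    (h1 : x ≤ (cuspStrip z).re) (h2 : (cuspStrip z).re ≤ 2 * x) :
    ‖cuspMap z - (1 - 1 / x : ℝ)‖ ≤ 14 / 15 * (15 / 16 / x) := by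
  have hX := one_lt_cuspStrip_re hz
  have hY := abs_lt.1 (abs_cuspStrip_im_lt hz)
  have h0 := cuspStrip_ne_zero hz
  rw [cuspMap_eq hz]
  set u := cuspStrip z
  have hx0 : (x : ℂ) ≠ 0 := by
    have : x ≠ 0 := by linarith
    exact_mod_cast this
  have e : 1 - 1 / u - ((1 - 1 / x : ℝ) : ℂ) = (u - x) / (u * x) := by
    push_cast
    field_simp
    ring
  have hu0 : 0 < ‖u‖ := norm_pos_iff.2 h0
  rw [e, norm_div, norm_mul, Complex.norm_real, Real.norm_of_nonneg (by linarith),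
    div_le_iff₀ (by positivity)]
  have e2 : 14 / 15 * (15 / 16 / x) * (‖u‖ * x) = 7 / 8 * ‖u‖ := by field_simp; norm_num
  rw [e2, ← sq_le_sq₀ (norm_nonneg _) (by positivity), mul_pow, ← Complex.normSq_eq_norm_sq,
    ← Complex.normSq_eq_norm_sq, Complex.normSq_apply, Complex.normSq_apply]
  simp only [Complex.sub_re, Complex.sub_im, Complex.ofReal_re, Complex.ofReal_im, sub_zero]
  nlinarith

/-- The centres of the disks that cover `χ(𝔻)`. -/
def cuspCenter (j : ℕ) : ℂ := ((1 - 1 / (2 : ℝ) ^ j : ℝ) : ℂ)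

theorem norm_cuspCenter (j : ℕ) : ‖cuspCenter j‖ = 1 - 1 / (2 : ℝ) ^ j := by
  rw [cuspCenter, Complex.norm_real, Real.norm_of_nonneg]
  rw [sub_nonneg, div_le_one (by positivity)]
  exact one_le_pow₀ (by norm_num)

/-- The zero conditions at level `n`: the coefficient `a_k(f)` vanishes to order `64 n` at the
centre number `j < n`, for all `k` with `k 2^{θ j} ≤ n`. The factor `64` is chosen so that
`16 * (14 / 15) ^ 64 ≤ 1 / 2`. -/
def VanishesAtLevel (θ : ℝ) (n : ℕ) (f : HardyBidisk) : Prop :=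
  ∀ j < n, ∀ k : ℕ, (k : ℝ) * ((2 : ℝ) ^ j) ^ θ ≤ n → ∀ i < 64 * n,
    taylorCoeff (diagCoeff k f) (cuspCenter j) i = 0

/-- The bound near the `j`-th centre, obtained from the zero of order `N`: on the disk of radius
`(15 / 16) 2⁻ʲ` one has `1 - |w| ≥ 2⁻ʲ / 16`. -/
theorem norm_diagCoeff_le_of_vanish {k N j : ℕ} {f : HardyBidisk} {z : ℂ}
    (hz : z ∈ ball (0 : ℂ) 1) (h1 : (2 : ℝ) ^ j ≤ (cuspStrip z).re)
    (h2 : (cuspStrip z).re ≤ 2 ^ (j + 1))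
    (hv : ∀ i < N, taylorCoeff (diagCoeff k f) (cuspCenter j) i = 0) :
    ‖diagCoeff k f (cuspMap z)‖ ≤ ‖f‖ * (16 * 2 ^ j) ^ (k + 2) * (15 * (14 / 15) ^ N) := by
  have hx : 1 ≤ (2 : ℝ) ^ j := one_le_pow₀ (by norm_num)
  set x := (2 : ℝ) ^ j
  have hsmall : ∀ w ∈ closedBall (cuspCenter j) (15 / 16 / x), ‖w‖ ≤ 1 - 1 / (16 * x) := by
    intro w hw
    have hw' : ‖w - cuspCenter j‖ ≤ 15 / 16 / x := mem_closedBall_iff_norm.1 hw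
    have h3 := norm_add_le (w - cuspCenter j) (cuspCenter j)
    rw [sub_add_cancel, norm_cuspCenter] at h3
    have : 15 / 16 / x + (1 - 1 / x) = 1 - 1 / (16 * x) := by field_simp; ring
    linarith
  have hpos : 0 < 1 / (16 * x) := by positivity
  have hd : DiffContOnCl ℂ (diagCoeff k f) (ball (cuspCenter j) (15 / 16 / x)) := by
    refine DifferentiableOn.diffContOnCl ?_
    refine (differentiableOn_diagCoeff k f).mono fun w hw => ?_
    have := hsmall w (closure_ball_subset_closedBall hw)
    rw [mem_ball_zero_iff]
    linarith
  have hB : ∀ w ∈ sphere (cuspCenter j) (15 / 16 / x),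
      ‖diagCoeff k f w‖ ≤ ‖f‖ * (16 * x) ^ (k + 2) := by
    intro w hw
    have hw1 := hsmall w (sphere_subset_closedBall hw)
    refine (norm_diagCoeff_le k f (by linarith)).trans ?_
    have hw0 : 0 < 1 - ‖w‖ := by linarith
    have hinv : (1 - ‖w‖)⁻¹ ≤ 16 * x := by
      rw [inv_le_comm₀ hw0 (by positivity), ← one_div]
      linarith
    rw [div_eq_mul_inv, ← inv_pow]
    gcongr
  have h3 := norm_cuspMap_sub_center_le hz hx h1 (by rw [pow_succ'] at h2; exact h2)
  have := norm_le_of_taylorCoeff_eq_zero (by positivity) hd hB hv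
    (show (0 : ℝ) ≤ 14 / 15 by norm_num) (by norm_num) h3
  refine this.trans (le_of_eq ?_)
  ring

/-- The coefficients of `f ∘ Φ` decay geometrically in `k`, and exponentially in the level `n`
when `f` satisfies the zero conditions at this level. -/
theorem norm_diagCoeff_cusp_le {θ c δ : ℝ} (hθ0 : 0 < θ) (hc0 : 0 < c) (hδ : 0 < δ)
    (hw : ∀ z ∈ ball (0 : ℂ) 1, c * ‖phi θ (cuspMap z)‖ * Real.exp (δ * (cuspStrip z).re ^ θ) ≤
        3 / 5 * (1 - ‖cuspMap z‖)) {n : ℕ} {f : HardyBidisk} (hf : VanishesAtLevel θ n f) (k : ℕ)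
    {z : ℂ} (hz : z ∈ ball (0 : ℂ) 1) :
    (c * ‖phi θ (cuspMap z)‖) ^ k * ‖diagCoeff k f (cuspMap z)‖ ≤
      3840 * (3 / 5) ^ k * max (1 / 2) (Real.exp (-δ)) ^ n * ‖f‖ * (cuspStrip z).re ^ 3 := by
  have hX := one_lt_cuspStrip_re hz
  have hge := one_sub_norm_cuspMap_ge hz
  have hle := one_sub_norm_cuspMap_le hz
  have hlt := norm_cuspMap_lt_one hz
  have hwz := hw z hz
  set X := (cuspStrip z).re
  set p := c * ‖phi θ (cuspMap z)‖
  set Q := max (1 / 2) (Real.exp (-δ))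
  set d := 1 - ‖cuspMap z‖
  have hp0 : 0 ≤ p := by positivity
  have hd : 0 < d := by simp only [d]; linarith
  have hXθ : 0 < X ^ θ := Real.rpow_pos_of_pos (by linarith) _
  have hQ0 : 0 < Q := lt_max_of_lt_left (by norm_num)
  have hpd : p ≤ 3 / 5 * d * Real.exp (-(δ * X ^ θ)) := by
    rw [Real.exp_neg, ← div_eq_mul_inv, le_div_iff₀ (Real.exp_pos _)]
    exact hwz
  have hpd' : p ≤ 3 / 5 * d := hpd.trans
    (mul_le_of_le_one_right (by positivity) (Real.exp_le_one_iff.2 (by nlinarith)))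
  have hXX : X ^ 2 ≤ X ^ 3 := pow_le_pow_right₀ hX.le (by norm_num)
  -- the estimate without zero conditions
  have hgen : p ^ k * ‖diagCoeff k f (cuspMap z)‖ ≤
      (3 / 5) ^ k * Real.exp (-(δ * X ^ θ)) ^ k * ‖f‖ * (16 * X ^ 2) := by
    have hdinv : 1 / d ≤ 4 * X := by
      rw [div_le_iff₀ hd]
      rw [div_le_iff₀ (by positivity)] at hge
      linarith
    calc p ^ k * ‖diagCoeff k f (cuspMap z)‖
        ≤ (3 / 5 * d * Real.exp (-(δ * X ^ θ))) ^ k * (‖f‖ / d ^ (k + 2)) := by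
          gcongr
          exact norm_diagCoeff_le k f hlt
      _ = (3 / 5) ^ k * Real.exp (-(δ * X ^ θ)) ^ k * ‖f‖ * (1 / d) ^ 2 := by
          rw [mul_pow, mul_pow, pow_add]
          field_simp
      _ ≤ (3 / 5) ^ k * Real.exp (-(δ * X ^ θ)) ^ k * ‖f‖ * (4 * X) ^ 2 := by gcongr
      _ = _ := by ring
  -- very close to `1`, one power of `X` absorbs the factor `2⁻ⁿ`
  by_cases hXn : (2 : ℝ) ^ n ≤ X
  · have h1 : X ^ 2 ≤ Q ^ n * X ^ 3 := by
      have h2 : 1 ≤ Q ^ n * X := by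
        calc (1 : ℝ) = (1 / 2) ^ n * 2 ^ n := by rw [← mul_pow]; norm_num
          _ ≤ Q ^ n * X := by
            gcongr
            exact le_max_left _ _
      nlinarith [sq_nonneg X]
    have h2 : Real.exp (-(δ * X ^ θ)) ^ k ≤ 1 :=
      pow_le_one₀ (Real.exp_pos _).le (Real.exp_le_one_iff.2 (by nlinarith))
    calc _ ≤ _ := hgen
      _ ≤ (3 / 5) ^ k * 1 * ‖f‖ * (16 * (Q ^ n * X ^ 3)) := by gcongr
      _ = 16 * ((3 / 5) ^ k * Q ^ n * ‖f‖ * X ^ 3) := by ring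
      _ ≤ 3840 * ((3 / 5) ^ k * Q ^ n * ‖f‖ * X ^ 3) := by gcongr; norm_num
      _ = _ := by ring
  obtain ⟨j, hj1, hj2⟩ := exists_nat_pow_near hX.le (one_lt_two : (1 : ℝ) < 2)
  have hjn : j < n := by
    by_contra h
    push Not at h hXn
    exact absurd (hj1.trans_lt hXn) (not_lt.2 (pow_le_pow_right₀ one_le_two h))
  by_cases hk : (k : ℝ) * ((2 : ℝ) ^ j) ^ θ ≤ n
  · -- the zero of order `64 n` wins over the constants `16 ^ k`, since `k ≤ n`
    have h1 := norm_diagCoeff_le_of_vanish hz hj1 hj2.le (hf j hjn k hk)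
    have hx1 : 1 ≤ (2 : ℝ) ^ j := one_le_pow₀ (by norm_num)
    have hkn : k ≤ n := by
      have h2 : (1 : ℝ) ≤ ((2 : ℝ) ^ j) ^ θ := Real.one_le_rpow hx1 hθ0.le
      have : (k : ℝ) ≤ n := by nlinarith [(Nat.cast_nonneg k : (0 : ℝ) ≤ k)]
      exact_mod_cast this
    set x := (2 : ℝ) ^ j
    have hpx : p ≤ 3 / 5 * (1 / x) := by
      refine hpd'.trans ?_
      gcongr
      exact hle.trans (one_div_le_one_div_of_le (by linarith) hj1)
    have hQn : (16 : ℝ) ^ k * (14 / 15) ^ (64 * n) ≤ Q ^ n := by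
      calc (16 : ℝ) ^ k * (14 / 15) ^ (64 * n) ≤ 16 ^ n * (14 / 15) ^ (64 * n) := by
            gcongr; norm_num
        _ = (16 * (14 / 15) ^ 64) ^ n := by rw [mul_pow, pow_mul]
        _ ≤ (1 / 2) ^ n := by gcongr; norm_num
        _ ≤ Q ^ n := by gcongr; exact le_max_left _ _
    calc p ^ k * ‖diagCoeff k f (cuspMap z)‖
        ≤ (3 / 5 * (1 / x)) ^ k * (‖f‖ * (16 * x) ^ (k + 2) * (15 * (14 / 15) ^ (64 * n))) := by
          gcongr
      _ = 3840 * (3 / 5) ^ k * (16 ^ k * (14 / 15) ^ (64 * n)) * ‖f‖ * x ^ 2 := by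
          rw [mul_pow, mul_pow, one_div_pow, pow_add, pow_add]
          field_simp
          ring
      _ ≤ 3840 * (3 / 5) ^ k * Q ^ n * ‖f‖ * X ^ 2 := by gcongr
      _ ≤ _ := by gcongr
  · -- no zero is imposed, but the weight gives `exp (-δ k X^θ) ≤ exp (-δ n)`
    push Not at hk
    have h1 : Real.exp (-(δ * X ^ θ)) ^ k ≤ Q ^ n := by
      calc Real.exp (-(δ * X ^ θ)) ^ k = Real.exp (-(δ * (k * X ^ θ))) := by
            rw [← Real.exp_nat_mul]; congr 1; ring
        _ ≤ Real.exp (-(δ * n)) := by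
            rw [Real.exp_le_exp, neg_le_neg_iff]
            gcongr
            refine hk.le.trans ?_
            gcongr
        _ = Real.exp (-δ) ^ n := by rw [← Real.exp_nat_mul]; congr 1; ring
        _ ≤ Q ^ n := by gcongr; exact le_max_right _ _
    calc _ ≤ _ := hgen
      _ ≤ (3 / 5) ^ k * Q ^ n * ‖f‖ * (16 * X ^ 3) := by gcongr
      _ = 16 * ((3 / 5) ^ k * Q ^ n * ‖f‖ * X ^ 3) := by ring
      _ ≤ 3840 * ((3 / 5) ^ k * Q ^ n * ‖f‖ * X ^ 3) := by gcongr; norm_num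
      _ = _ := by ring

/-- Existence and size of `f ∘ Φ` in the Hardy space. -/
theorem exists_comp_cuspSymbol {θ c δ : ℝ} (hθ0 : 0 < θ) (hc0 : 0 < c) (hδ : 0 < δ)
    (hadm : CuspAdmissible θ c)
    (hw : ∀ z ∈ ball (0 : ℂ) 1, c * ‖phi θ (cuspMap z)‖ * Real.exp (δ * (cuspStrip z).re ^ θ) ≤
        3 / 5 * (1 - ‖cuspMap z‖)) {g : ℂ → ℂ} (hg : DifferentiableOn ℂ g (ball 0 1))
    (hg1 : ∀ z ∈ ball (0 : ℂ) 1, ‖g z‖ ≤ 1) :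
    ∃ K : ℝ, 0 < K ∧ ∀ (n : ℕ) (f : HardyBidisk), VanishesAtLevel θ n f →
      ∃ F : HardyBidisk, (∀ z ∈ bidisk, F.eval z = f.eval (cuspSymbol θ c g z)) ∧
        ‖F‖ ≤ K * max (1 / 2) (Real.exp (-δ)) ^ n * ‖f‖ := by
  obtain ⟨K, hK, h⟩ := exists_hardyBidisk_tsum
  refine ⟨K * (3840 * (13 ^ 3 * 2) * (1 - 3 / 5)⁻¹), by norm_num; exact hK, fun n f hf => ?_⟩
  set Q := max (1 / 2) (Real.exp (-δ))
  have hQ0 : 0 < Q := lt_max_of_lt_left (by norm_num)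
  have hmaps : MapsTo cuspMap (ball 0 1) (ball 0 1) := fun z hz => by
    simpa using norm_cuspMap_lt_one hz
  have hgeo : HasSum (fun k : ℕ => 3840 * Q ^ n * ‖f‖ * (13 ^ 3 * 2) * (3 / 5 : ℝ) ^ k)
      (3840 * Q ^ n * ‖f‖ * (13 ^ 3 * 2) * (1 - 3 / 5)⁻¹) :=
    (hasSum_geometric_of_lt_one (by norm_num) (by norm_num)).mul_left _
  have hbound : ∀ k, ∀ z ∈ ball (0 : ℂ) 1,
      ‖((c : ℂ) * phi θ (cuspMap z)) ^ k * diagCoeff k f (cuspMap z)‖ ≤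
        3840 * Q ^ n * ‖f‖ * (13 ^ 3 * 2) * (3 / 5) ^ k * ‖1 - z‖ ^ (-(1 / 4) : ℝ) := by
    intro k z hz
    rw [norm_mul, norm_pow, norm_mul, Complex.norm_real, Real.norm_of_nonneg hc0.le]
    refine (norm_diagCoeff_cusp_le hθ0 hc0 hδ hw hf k hz).trans ?_
    calc 3840 * (3 / 5) ^ k * Q ^ n * ‖f‖ * (cuspStrip z).re ^ 3
        ≤ 3840 * (3 / 5) ^ k * Q ^ n * ‖f‖ * (13 ^ 3 * 2 * ‖1 - z‖ ^ (-(1 / 4) : ℝ)) := by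
          gcongr
          exact cuspStrip_re_pow_le hz
      _ = _ := by ring
  obtain ⟨F, hF1, hF2⟩ := h
    (fun k z => ((c : ℂ) * phi θ (cuspMap z)) ^ k * diagCoeff k f (cuspMap z)) g
    (fun k => 3840 * Q ^ n * ‖f‖ * (13 ^ 3 * 2) * (3 / 5) ^ k)
    (fun k => ((((differentiableOn_phi θ).comp differentiableOn_cuspMap hmaps).const_mul _).pow k).mul
      ((differentiableOn_diagCoeff k f).comp differentiableOn_cuspMap hmaps))
    hg hg1 (fun k => by positivity) hgeo.summable hbound
  refine ⟨F, fun z hz => ?_, hF2.trans (le_of_eq ?_)⟩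
  · rw [hF1 z hz, cuspSymbol, eval_eq_tsum_diagCoeff]
    · exact tsum_congr fun k => by ring
    · have h1 := hadm z.1 hz.1
      have h2 := hg1 z.2 hz.2
      rw [norm_mul, norm_mul, Complex.norm_real, Real.norm_of_nonneg hc0.le]
      have h3 : 0 ≤ c * ‖phi θ (cuspMap z.1)‖ := by positivity
      nlinarith
  · rw [hgeo.tsum_eq]; ring

/-! ### Approximation numbers -/

theorem approximationNumber_nonneg {E F : Type*} [NormedAddCommGroup E] [NormedSpace ℂ E]
    [NormedAddCommGroup F] [NormedSpace ℂ F] (n : ℕ) (T : E →L[ℂ] F) :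
    0 ≤ approximationNumber n T :=
  Real.sInf_nonneg (by rintro _ ⟨R, -, rfl⟩; exact norm_nonneg _)

theorem approximationNumber_le {E F : Type*} [NormedAddCommGroup E] [NormedSpace ℂ E]
    [NormedAddCommGroup F] [NormedSpace ℂ F] {n : ℕ} {T R : E →L[ℂ] F}
    (hR : (R : E →ₗ[ℂ] F).rank < (n : Cardinal)) : approximationNumber n T ≤ ‖T - R‖ :=
  csInf_le ⟨0, by rintro _ ⟨R, -, rfl⟩; exact norm_nonneg _⟩ ⟨R, hR, rfl⟩

/-- An operator on a Hilbert space that is small on the common kernel of finitely many functionals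
is close to an operator of small rank, which factors through these functionals. -/
theorem exists_finite_rank_approx {H F ι : Type u} [NormedAddCommGroup H] [InnerProductSpace ℂ H]
    [CompleteSpace H] [NormedAddCommGroup F] [NormedSpace ℂ F] (T : H →L[ℂ] F) (S : Finset ι)
    (L : ι → H →L[ℂ] ℂ) {ε : ℝ} (hε : 0 ≤ ε)
    (hT : ∀ f, (∀ s ∈ S, L s f = 0) → ‖T f‖ ≤ ε * ‖f‖) :
    ∃ R : H →L[ℂ] F, (R : H →ₗ[ℂ] F).rank ≤ (S.card : Cardinal) ∧ IsCompactOperator R ∧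
      ‖T - R‖ ≤ ε := by
  let Λ : H →L[ℂ] (S → ℂ) := ContinuousLinearMap.pi fun s => L s
  let V : Submodule ℂ H := LinearMap.ker (Λ : H →ₗ[ℂ] (S → ℂ))
  have hVc : IsClosed (V : Set H) := Λ.isClosed_ker
  have : CompleteSpace V := hVc.completeSpace_coe
  let P : H →L[ℂ] H := V.starProjection
  let R : H →L[ℂ] F := T - T ∘L P
  have hker : ∀ f, Λ f = 0 → R f = 0 := by
    intro f hf
    have hfV : f ∈ V := hf
    have : P f = f := Submodule.starProjection_eq_self_iff.2 hfV
    simp [R, this]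
  -- a right inverse of `Λ` on its range makes `R` factor through `Λ`
  obtain ⟨G, hG⟩ : ∃ G : (S → ℂ) →ₗ[ℂ] F, (R : H →ₗ[ℂ] F) = G ∘ₗ (Λ : H →ₗ[ℂ] (S → ℂ)) := by
    let Λ' : H →ₗ[ℂ] (S → ℂ) := Λ
    obtain ⟨g, hg⟩ := Λ'.rangeRestrict.exists_rightInverse_of_surjective Λ'.range_rangeRestrict
    obtain ⟨G, hG⟩ := LinearMap.exists_extend ((R : H →ₗ[ℂ] F) ∘ₗ g)
    refine ⟨G, LinearMap.ext fun f => ?_⟩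
    have h1 : G (Λ f) = R (g (Λ'.rangeRestrict f)) := LinearMap.congr_fun hG (Λ'.rangeRestrict f)
    have h2 : Λ (g (Λ'.rangeRestrict f)) = Λ f :=
      congrArg Subtype.val (LinearMap.congr_fun hg (Λ'.rangeRestrict f))
    have h3 := hker (f - g (Λ'.rangeRestrict f)) (by rw [map_sub, h2, sub_self])
    rw [map_sub, sub_eq_zero] at h3
    exact h3.trans h1.symm
  refine ⟨R, ?_, ?_, ?_⟩
  · rw [hG]
    refine (LinearMap.rank_comp_le_left _ _).trans ((LinearMap.rank_le_domain G).trans ?_)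
    simp
  · have h1 : IsCompactOperator Λ := isCompactOperator_of_locallyCompactSpace_dom Λ
    have h2 := h1.clm_comp G.toContinuousLinearMap
    have h3 : (R : H → F) = G.toContinuousLinearMap ∘ Λ := by
      funext f
      exact LinearMap.congr_fun hG f
    rw [h3]
    exact h2
  · have : T - R = T ∘L P := by simp [R]
    rw [this]
    refine ContinuousLinearMap.opNorm_le_bound _ hε fun f => ?_
    have hPV : P f ∈ V := Submodule.starProjection_apply_mem V f
    have h0 : Λ (P f) = 0 := hPV
    refine (hT (P f) fun s hs => congrFun h0 ⟨s, hs⟩).trans ?_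
    gcongr
    exact Submodule.norm_starProjection_apply_le V f

theorem betaPlus_two_lt_one {E F : Type*} [NormedAddCommGroup E] [NormedSpace ℂ E]
    [NormedAddCommGroup F] [NormedSpace ℂ F] {T : E →L[ℂ] F} {τ C : ℝ} (hτ : 0 < τ) (hC : 0 < C)
    (h : ∀ n : ℕ, 1 ≤ n → approximationNumber (n ^ 2) T ≤ C * Real.exp (-τ * n)) :
    betaPlus 2 T < 1 := by
  have h1 : Tendsto (fun n : ℕ => ENNReal.ofReal (C ^ (1 / (n : ℝ)) * Real.exp (-τ))) atTop
      (𝓝 (ENNReal.ofReal (Real.exp (-τ)))) := by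
    refine ENNReal.tendsto_ofReal ?_
    have h2 : Tendsto (fun n : ℕ => C ^ (1 / (n : ℝ))) atTop (𝓝 (C ^ (0 : ℝ))) :=
      ((Real.continuousAt_const_rpow hC.ne').tendsto).comp tendsto_one_div_atTop_nhds_zero_nat
    simpa using h2.mul_const (Real.exp (-τ))
  have h2 : betaPlus 2 T ≤ ENNReal.ofReal (Real.exp (-τ)) := by
    rw [← h1.limsup_eq]
    refine limsup_le_limsup ?_
    filter_upwards [eventually_ge_atTop 1] with n hn
    refine ENNReal.ofReal_le_ofReal ?_
    have hn0 : (n : ℝ) ≠ 0 := by positivity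
    calc _ ≤ (C * Real.exp (-τ * n)) ^ (1 / (n : ℝ)) :=
          Real.rpow_le_rpow (approximationNumber_nonneg _ _) (h n hn) (by positivity)
      _ = _ := by
          rw [Real.mul_rpow hC.le (Real.exp_pos _).le, ← Real.exp_mul]
          congr 2
          field_simp
  refine h2.trans_lt ?_
  rw [← ENNReal.ofReal_one, ENNReal.ofReal_lt_ofReal_iff one_pos]
  exact Real.exp_zero ▸ Real.exp_lt_exp.2 (by linarith)

/-- Rescaling a bound for `a_m`, `m > K n²`, to a bound for `a_{n²}`. -/
theorem exists_exp_bound {a : ℕ → ℝ} {K B Q : ℝ} (hQ0 : 0 < Q) (hQ1 : Q < 1) (hB : 0 < B)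
    (h : ∀ n m : ℕ, K * (n : ℝ) ^ 2 < m → a m ≤ B * Q ^ n) :
    ∃ τ : ℝ, 0 < τ ∧ ∃ C : ℝ, 0 < C ∧ ∀ n : ℕ, 1 ≤ n → a (n ^ 2) ≤ C * Real.exp (-τ * n) := by
  obtain ⟨D, hD⟩ := exists_nat_gt (max K 1)
  have hDK : K < D := (le_max_left _ _).trans_lt hD
  have hD1 : (1 : ℝ) < D := (le_max_right _ _).trans_lt hD
  have hlog : Real.log Q < 0 := Real.log_neg hQ0 hQ1
  refine ⟨-Real.log Q / D, div_pos (by linarith) (by linarith), B / Q, by positivity,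
    fun n hn => ?_⟩
  have hn0 : (1 : ℝ) ≤ n := by exact_mod_cast hn
  have h1 : D * ((n / D : ℕ) : ℝ) ≤ n := by exact_mod_cast Nat.mul_div_le n D
  have h2 : (n : ℝ) / D < ((n / D : ℕ) : ℝ) + 1 := by
    rw [div_lt_iff₀ (by linarith)]
    have := Nat.lt_div_mul_add (a := n) (b := D) (by exact_mod_cast (by linarith : (0 : ℝ) < D))
    have h3 : n < (n / D + 1) * D := by rw [add_mul, one_mul]; exact this
    exact_mod_cast h3
  set d := n / D
  have hd0 : (0 : ℝ) ≤ d := Nat.cast_nonneg d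
  refine (h d (n ^ 2) ?_).trans ?_
  · push_cast
    have h4 : ((D : ℝ) * d) ^ 2 ≤ (n : ℝ) ^ 2 := by gcongr
    rcases hd0.eq_or_lt with h0 | h0
    · rw [← h0]; nlinarith
    · have : K * (d : ℝ) ^ 2 < D * d ^ 2 := by gcongr
      have : (D : ℝ) * d ^ 2 ≤ D ^ 2 * d ^ 2 := by
        gcongr
        nlinarith
      nlinarith
  · rw [div_mul_eq_mul_div, mul_div_assoc]
    gcongr
    rw [le_div_iff₀ hQ0, ← pow_succ, ← Real.exp_log (pow_pos hQ0 _), Real.log_pow,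
      Real.exp_le_exp]
    push_cast
    have e : -(-Real.log Q / D) * n = (n / D) * Real.log Q := by ring
    rw [e]
    nlinarith

/-! ### The zero conditions as functionals -/

/-- The Taylor coefficients of `a_k(f)` at a point of the disk are bounded linear functionals. -/
theorem exists_taylorCoeff_diagCoeff_functional (k i : ℕ) {ζ : ℂ} (hζ : ‖ζ‖ < 1) :
    ∃ L : HardyBidisk →L[ℂ] ℂ, ∀ f, L f = taylorCoeff (diagCoeff k f) ζ i := by
  have hat : ∀ f, ContDiffAt ℂ i (diagCoeff k f) ζ := fun f =>
    ((differentiableOn_diagCoeff k f).analyticAt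
      (isOpen_ball.mem_nhds (by simpa using hζ))).contDiffAt
  let L : HardyBidisk →ₗ[ℂ] ℂ :=
    { toFun := fun f => taylorCoeff (diagCoeff k f) ζ i
      map_add' := fun f g => by
        have : diagCoeff k (f + g) =ᶠ[𝓝 ζ] diagCoeff k f + diagCoeff k g := by
          filter_upwards [isOpen_ball.mem_nhds (show ζ ∈ ball (0 : ℂ) 1 by simpa using hζ)] with w hw
          exact diagCoeff_add k f g (by simpa using hw)
        simp only [taylorCoeff]
        rw [this.iteratedDeriv_eq, iteratedDeriv_add (hat f) (hat g), mul_add]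
      map_smul' := fun c f => by
        have : diagCoeff k (c • f) = c • diagCoeff k f := by
          funext w
          exact diagCoeff_smul k c f w
        simp only [taylorCoeff, RingHom.id_apply, smul_eq_mul]
        rw [this, iteratedDeriv_const_smul_field]
        simp only [smul_eq_mul]
        ring }
  set ρ := (1 - ‖ζ‖) / 2 with hρdef
  have hρ : 0 < ρ := by rw [hρdef]; linarith
  have hsmall : ∀ w ∈ closedBall ζ ρ, ‖w‖ ≤ 1 - ρ := by
    intro w hw
    have h1 := norm_add_le (w - ζ) ζ
    rw [sub_add_cancel] at h1
    have := mem_closedBall_iff_norm.1 hw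
    linarith
  have hb : ∀ f, ‖L f‖ ≤ 1 / ρ ^ (k + 2) / ρ ^ i * ‖f‖ := by
    intro f
    have hd : DiffContOnCl ℂ (diagCoeff k f) (ball ζ ρ) := by
      refine ((differentiableOn_diagCoeff k f).mono fun w hw => ?_).diffContOnCl
      have := hsmall w (closure_ball_subset_closedBall hw)
      rw [mem_ball_zero_iff]
      linarith
    refine (norm_taylorCoeff_le (C := ‖f‖ / ρ ^ (k + 2)) hρ hd (fun w hw => ?_) i).trans
      (le_of_eq (by ring))
    have h1 := hsmall w (sphere_subset_closedBall hw)
    refine (norm_diagCoeff_le k f (by linarith)).trans ?_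
    gcongr
    linarith
  exact ⟨L.mkContinuous _ hb, fun f => rfl⟩

/-- The zero conditions at level `n` involve `O(n²)` functionals: `64 n` for each pair `(j, k)`,
and there are at most `n 2^{-θ j} + 1` values of `k` for each `j < n`. -/
theorem exists_functionals {θ : ℝ} (hθ0 : 0 < θ) : ∃ K : ℝ, ∀ n : ℕ,
    ∃ (S : Finset ((_ : ℕ) × ℕ × ℕ)) (L : ((_ : ℕ) × ℕ × ℕ) → HardyBidisk →L[ℂ] ℂ),
      (S.card : ℝ) ≤ K * (n : ℝ) ^ 2 ∧
      ∀ f, (∀ s ∈ S, L s f = 0) → VanishesAtLevel θ n f := by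
  set q : ℝ := (2 : ℝ) ^ (-θ) with hq
  have hq0 : 0 < q := Real.rpow_pos_of_pos two_pos _
  have hq1 : q < 1 := Real.rpow_lt_one_of_one_lt_of_neg one_lt_two (by linarith)
  refine ⟨64 * ((1 - q)⁻¹ + 1), fun n => ?_⟩
  have hc : ∀ j, ‖cuspCenter j‖ < 1 := fun j => by
    rw [norm_cuspCenter]
    have : 0 < 1 / (2 : ℝ) ^ j := by positivity
    linarith
  choose L hL using fun s : (_ : ℕ) × ℕ × ℕ =>
    exists_taylorCoeff_diagCoeff_functional s.2.1 s.2.2 (hc s.1)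
  refine ⟨(Finset.range n).sigma fun j =>
    Finset.range (⌊(n : ℝ) * q ^ j⌋₊ + 1) ×ˢ Finset.range (64 * n), L, ?_, ?_⟩
  · rw [Finset.card_sigma]
    push_cast [Finset.card_product, Finset.card_range]
    have h1 : ∑ j ∈ Finset.range n, q ^ j ≤ (1 - q)⁻¹ :=
      sum_le_hasSum _ (fun _ _ => by positivity) (hasSum_geometric_of_lt_one hq0.le hq1)
    calc ∑ j ∈ Finset.range n, ((⌊(n : ℝ) * q ^ j⌋₊ : ℝ) + 1) * (64 * n)
        ≤ ∑ j ∈ Finset.range n, ((n : ℝ) * q ^ j + 1) * (64 * n) := by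
          gcongr with j
          exact Nat.floor_le (by positivity)
      _ = 64 * n * (n * ∑ j ∈ Finset.range n, q ^ j + n) := by
          rw [← Finset.sum_mul, Finset.sum_add_distrib, ← Finset.mul_sum]
          simp
          ring
      _ ≤ 64 * n * (n * (1 - q)⁻¹ + n) := by gcongr
      _ = _ := by ring
  · intro f hf j hj k hk i hi
    rw [← hL ⟨j, k, i⟩]
    refine hf _ ?_
    simp only [Finset.mem_sigma, Finset.mem_product, Finset.mem_range]
    refine ⟨hj, ?_, hi⟩
    rw [Nat.lt_add_one_iff]
    refine Nat.le_floor ?_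
    have hx : (0 : ℝ) < ((2 : ℝ) ^ j) ^ θ := by positivity
    have e : q ^ j = (((2 : ℝ) ^ j) ^ θ)⁻¹ := by
      rw [hq, ← Real.rpow_neg (by positivity), ← Real.rpow_natCast, ← Real.rpow_natCast,
        ← Real.rpow_mul two_pos.le, ← Real.rpow_mul two_pos.le, mul_comm]
    rw [e, ← div_eq_mul_inv, le_div_iff₀ hx]
    exact hk

/-! ### The symbol and its composition operator -/

/-- The Jacobian determinant of a map whose first component depends on `z₁` only. -/
theorem det_lowerTriangular (a b d : ℂ) :
    ((a • ContinuousLinearMap.fst ℂ ℂ ℂ).prod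
      (b • ContinuousLinearMap.fst ℂ ℂ ℂ + d • ContinuousLinearMap.snd ℂ ℂ ℂ)).det = a * d := by
  rw [ContinuousLinearMap.det, ← LinearMap.det_toMatrix (Module.Basis.finTwoProd ℂ),
    Matrix.det_fin_two]
  simp [LinearMap.toMatrix_apply]

theorem phi_cuspMap_ne_zero (θ : ℝ) {z : ℂ} (hz : z ∈ ball (0 : ℂ) 1) :
    phi θ (cuspMap z) ≠ 0 := by
  have h : cuspMap z ≠ 1 := by
    intro h
    have := norm_cuspMap_lt_one hz
    rw [h] at this
    simp at this
  rw [phi, if_neg h]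
  exact Complex.exp_ne_zero _

theorem mapsTo_cuspMap : MapsTo cuspMap (ball 0 1) (ball 0 1) := fun z hz => by
  simpa using norm_cuspMap_lt_one hz

theorem mapsTo_cuspSymbol {θ c : ℝ} (hc0 : 0 < c) (hadm : CuspAdmissible θ c) {g : ℂ → ℂ}
    (hg1 : ∀ z ∈ ball (0 : ℂ) 1, ‖g z‖ ≤ 1) : MapsTo (cuspSymbol θ c g) bidisk bidisk := by
  intro z hz
  refine ⟨mapsTo_cuspMap hz.1, ?_⟩
  rw [mem_ball_zero_iff]
  have h1 := hadm z.1 hz.1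
  have h2 := hg1 z.2 hz.2
  refine (norm_add_le _ _).trans_lt ?_
  rw [norm_mul, norm_mul, Complex.norm_real, Real.norm_of_nonneg hc0.le]
  have h3 : 0 ≤ c * ‖phi θ (cuspMap z.1)‖ := by positivity
  nlinarith

theorem nonDegenerate_cuspSymbol {θ c : ℝ} (hc0 : 0 < c) {g : ℂ → ℂ}
    (hg : DifferentiableOn ℂ g (ball 0 1)) (hne : ¬ ∃ a : ℂ, ∀ z ∈ ball (0 : ℂ) 1, g z = a) :
    NonDegenerate (cuspSymbol θ c g) := by
  obtain ⟨z₁, hz₁, h1⟩ := exists_deriv_cuspMap_ne_zero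
  obtain ⟨z₂, hz₂, h2⟩ : ∃ z ∈ ball (0 : ℂ) 1, deriv g z ≠ 0 := by
    by_contra! h
    exact hne (isOpen_ball.exists_is_const_of_deriv_eq_zero (convex_ball _ _).isPreconnected hg h)
  refine ⟨(z₁, z₂), ⟨hz₁, hz₂⟩, ?_⟩
  have hχ : HasDerivAt cuspMap (deriv cuspMap z₁) z₁ :=
    (differentiableOn_cuspMap.differentiableAt (isOpen_ball.mem_nhds hz₁)).hasDerivAt
  have hgd : HasDerivAt g (deriv g z₂) z₂ :=
    (hg.differentiableAt (isOpen_ball.mem_nhds hz₂)).hasDerivAt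
  have hφ : HasDerivAt (fun z => phi θ (cuspMap z)) (deriv (fun z => phi θ (cuspMap z)) z₁) z₁ :=
    (((differentiableOn_phi θ).comp differentiableOn_cuspMap mapsTo_cuspMap).differentiableAt
      (isOpen_ball.mem_nhds hz₁)).hasDerivAt
  have e1 : HasFDerivAt (fun z : ℂ × ℂ => cuspMap z.1)
      (deriv cuspMap z₁ • ContinuousLinearMap.fst ℂ ℂ ℂ) (z₁, z₂) :=
    HasDerivAt.comp_hasFDerivAt (z₁, z₂) hχ hasFDerivAt_fst
  have e2 : HasFDerivAt (fun z : ℂ × ℂ => phi θ (cuspMap z.1))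
      (deriv (fun z => phi θ (cuspMap z)) z₁ • ContinuousLinearMap.fst ℂ ℂ ℂ) (z₁, z₂) :=
    hφ.comp_hasFDerivAt (f := Prod.fst) (z₁, z₂) hasFDerivAt_fst
  have e3 : HasFDerivAt (fun z : ℂ × ℂ => g z.2)
      (deriv g z₂ • ContinuousLinearMap.snd ℂ ℂ ℂ) (z₁, z₂) :=
    HasDerivAt.comp_hasFDerivAt (z₁, z₂) hgd hasFDerivAt_snd
  have e4 := e1.prodMk (e1.add ((e2.const_mul (c : ℂ)).mul e3))
  have e5 : HasFDerivAt (cuspSymbol θ c g)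
      ((deriv cuspMap z₁ • ContinuousLinearMap.fst ℂ ℂ ℂ).prod
        ((deriv cuspMap z₁ + g z₂ * c * deriv (fun z => phi θ (cuspMap z)) z₁) •
            ContinuousLinearMap.fst ℂ ℂ ℂ +
          (c * phi θ (cuspMap z₁) * deriv g z₂) • ContinuousLinearMap.snd ℂ ℂ ℂ)) (z₁, z₂) := by
    refine HasFDerivAt.congr_fderiv e4 ?_
    ext <;> simp
    ring
  rw [e5.fderiv, det_lowerTriangular]
  have hc : (c : ℂ) ≠ 0 := by exact_mod_cast hc0.ne'
  exact mul_ne_zero h1 (mul_ne_zero (mul_ne_zero hc (phi_cuspMap_ne_zero θ hz₁)) h2)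

theorem inBidiskAlgebra_fst {f : ℂ → ℂ} (hf : InDiskAlgebra f) :
    InBidiskAlgebra fun z => f z.1 :=
  ⟨hf.1.comp differentiableOn_fst fun _ hz => hz.1,
    hf.2.comp continuousOn_fst fun _ hz => hz.1⟩

theorem inBidiskAlgebra_snd {f : ℂ → ℂ} (hf : InDiskAlgebra f) :
    InBidiskAlgebra fun z => f z.2 :=
  ⟨hf.1.comp differentiableOn_snd fun _ hz => hz.2,
    hf.2.comp continuousOn_snd fun _ hz => hz.2⟩

theorem inDiskAlgebra_cuspMap : InDiskAlgebra cuspMap :=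
  ⟨differentiableOn_cuspMap, continuousOn_cuspMap⟩

theorem inDiskAlgebra_phi_cuspMap {θ : ℝ} (hθ0 : 0 < θ) (hθ1 : θ < 1) :
    InDiskAlgebra fun z => phi θ (cuspMap z) :=
  ⟨(differentiableOn_phi θ).comp differentiableOn_cuspMap mapsTo_cuspMap,
    (continuousOn_phi hθ0 hθ1).comp continuousOn_cuspMap fun z hz => by
      simpa using norm_cuspMap_le_one hz⟩

theorem inBidiskAlgebra_cuspSymbol_snd {θ c : ℝ} (hθ0 : 0 < θ) (hθ1 : θ < 1) {g : ℂ → ℂ}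
    (hg : InDiskAlgebra g) : InBidiskAlgebra fun z => (cuspSymbol θ c g z).2 := by
  have h1 := inBidiskAlgebra_fst inDiskAlgebra_cuspMap
  have h2 := inBidiskAlgebra_fst (inDiskAlgebra_phi_cuspMap hθ0 hθ1)
  have h3 := inBidiskAlgebra_snd hg
  exact ⟨h1.1.add ((h2.1.const_mul (c : ℂ)).mul h3.1),
    h1.2.add ((h2.2.const_mul (c : ℂ)).mul h3.2)⟩

theorem cuspSymbol_one (θ c : ℝ) (g : ℂ → ℂ) : cuspSymbol θ c g (1, 1) = (1, 1) := by
  simp [cuspSymbol, cuspMap_one, phi]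

/-- A self-map of the bidisk for which `f ∘ Φ` is always in the Hardy space, with a norm bound, has a
composition operator: linearity follows from the uniqueness of Taylor coefficients. -/
theorem exists_compositionOperator {Φ : ℂ × ℂ → ℂ × ℂ} (hΦ : MapsTo Φ bidisk bidisk) {K : ℝ}
    (h : ∀ f : HardyBidisk, ∃ F : HardyBidisk, (∀ z ∈ bidisk, F.eval z = f.eval (Φ z)) ∧
      ‖F‖ ≤ K * ‖f‖) :
    ∃ T : HardyBidisk →L[ℂ] HardyBidisk, IsCompositionOperator Φ T := by
  choose T hT hTK using h
  let T' : HardyBidisk →ₗ[ℂ] HardyBidisk :=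
    { toFun := T
      map_add' := fun f g => HardyBidisk.eval_injective fun z hz => by
        rw [hT _ z hz, HardyBidisk.eval_add _ _ hz, hT _ z hz, hT _ z hz,
          HardyBidisk.eval_add _ _ (hΦ hz)]
      map_smul' := fun c f => HardyBidisk.eval_injective fun z hz => by
        rw [RingHom.id_apply, hT _ z hz, HardyBidisk.eval_smul, HardyBidisk.eval_smul,
          hT _ z hz] }
  exact ⟨T'.mkContinuous K hTK, hT⟩

/-- Compactness and the decay of the approximation numbers come from the same approximants, one for
each level `n`, of rank `O(n²)` and error `O(Qⁿ)`. -/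
theorem exists_cuspSymbol_operator {θ c : ℝ} (hθ0 : 0 < θ) (hθ1 : θ < 1) (hc0 : 0 < c) (hc1 : c < 1)
    (hadm : CuspAdmissible θ c) {g : ℂ → ℂ} (hg : DifferentiableOn ℂ g (ball 0 1))
    (hg1 : ∀ z ∈ ball (0 : ℂ) 1, ‖g z‖ ≤ 1) :
    ∃ T : HardyBidisk →L[ℂ] HardyBidisk, IsCompositionOperator (cuspSymbol θ c g) T ∧
      IsCompactOperator T ∧
      ∃ τ : ℝ, 0 < τ ∧ ∃ C : ℝ, 0 < C ∧ ∀ n : ℕ, 1 ≤ n →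
          approximationNumber (n ^ 2) T ≤ C * Real.exp (-τ * n) := by
  obtain ⟨δ, hδ, hw⟩ := exists_weight hθ0 hθ1 hc1 hadm
  obtain ⟨B, hB, hcomp⟩ := exists_comp_cuspSymbol hθ0 hc0 hδ hadm hw hg hg1
  set Q := max (1 / 2) (Real.exp (-δ))
  have hQ0 : 0 < Q := lt_max_of_lt_left (by norm_num)
  have hQ1 : Q < 1 := max_lt (by norm_num) (Real.exp_zero ▸ Real.exp_lt_exp.2 (by linarith))
  obtain ⟨T, hT⟩ := exists_compositionOperator (mapsTo_cuspSymbol hc0 hadm hg1) (K := B)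
    fun f => by
      -- at level `0` there are no conditions
      simpa using hcomp 0 f fun j hj => absurd hj (Nat.not_lt_zero j)
  have hTn : ∀ n f, VanishesAtLevel θ n f → ‖T f‖ ≤ B * Q ^ n * ‖f‖ := by
    intro n f hf
    obtain ⟨F, hF1, hF2⟩ := hcomp n f hf
    have : T f = F := HardyBidisk.eval_injective fun z hz => by rw [hT f z hz, hF1 z hz]
    rwa [this]
  obtain ⟨K, hK⟩ := exists_functionals hθ0
  have happ : ∀ n : ℕ, ∃ R : HardyBidisk →L[ℂ] HardyBidisk, ∃ m : ℕ, (m : ℝ) ≤ K * (n : ℝ) ^ 2 ∧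
      (R : HardyBidisk →ₗ[ℂ] HardyBidisk).rank ≤ (m : Cardinal) ∧ IsCompactOperator R ∧
      ‖T - R‖ ≤ B * Q ^ n := by
    intro n
    obtain ⟨S, L, hS, hL⟩ := hK n
    obtain ⟨R, hR1, hR2, hR3⟩ := exists_finite_rank_approx T S L (ε := B * Q ^ n) (by positivity)
      fun f hf => hTn n f (hL f hf)
    exact ⟨R, S.card, hS, hR1, hR2, hR3⟩
  choose R m hm hrank hcpt hnorm using happ
  refine ⟨T, hT, ?_, ?_⟩
  · have hlim : Tendsto R atTop (𝓝 T) := by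
      rw [tendsto_iff_norm_sub_tendsto_zero]
      have h0 : Tendsto (fun n => B * Q ^ n) atTop (𝓝 0) := by
        simpa using (tendsto_pow_atTop_nhds_zero_of_lt_one hQ0.le hQ1).const_mul B
      refine squeeze_zero (fun _ => norm_nonneg _) (fun n => ?_) h0
      rw [norm_sub_rev]
      exact hnorm n
    exact isCompactOperator_of_tendsto hlim (Eventually.of_forall hcpt)
  · refine exists_exp_bound (a := fun n => approximationNumber n T) (K := K) hQ0 hQ1 hB
      fun n k hk => (approximationNumber_le ?_).trans (hnorm n)
    refine (hrank n).trans_lt ?_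
    have : (m n : ℝ) < k := (hm n).trans_lt hk
    exact_mod_cast this

end

theorem theorem6p1 (θ : ℝ) (hθ0 : 0 < θ) (hθ1 : θ < 1) :
    (∃ c₀ : ℝ, 0 < c₀ ∧ c₀ ≤ 1 ∧ ∀ c : ℝ, 0 < c → c < c₀ → CuspAdmissible θ c) ∧
    ∀ c : ℝ, 0 < c → c < 1 → CuspAdmissible θ c →
    ∀ g : ℂ → ℂ, InDiskAlgebra g → (∀ z ∈ closedBall (0 : ℂ) 1, ‖g z‖ ≤ 1) →
      MapsTo (cuspSymbol θ c g) bidisk bidisk ∧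
      ((¬ ∃ a : ℂ, ∀ z ∈ ball (0 : ℂ) 1, g z = a) → NonDegenerate (cuspSymbol θ c g)) ∧
      InBidiskAlgebra (fun z => (cuspSymbol θ c g z).1) ∧
      InBidiskAlgebra (fun z => (cuspSymbol θ c g z).2) ∧
      cuspSymbol θ c g (1, 1) = (1, 1) ∧
      (cuspSymbol θ c g '' torus ∩ torus).Nonempty ∧
      ∃ T : HardyBidisk →L[ℂ] HardyBidisk,
        IsCompositionOperator (cuspSymbol θ c g) T ∧
        IsCompactOperator T ∧
        (∃ τ : ℝ, 0 < τ ∧ ∃ C : ℝ, 0 < C ∧ ∀ n : ℕ, 1 ≤ n →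
          approximationNumber (n ^ 2) T ≤ C * Real.exp (-τ * n)) ∧
        betaPlus 2 T < 1 := by
  refine ⟨exists_cuspAdmissible hθ0 hθ1, fun c hc0 hc1 hadm g hg hg1 => ?_⟩
  have hg1' : ∀ z ∈ ball (0 : ℂ) 1, ‖g z‖ ≤ 1 := fun z hz => hg1 z (ball_subset_closedBall hz)
  have hone : ((1, 1) : ℂ × ℂ) ∈ torus := by simp [torus]
  obtain ⟨T, hT, hcpt, τ, hτ, C, hC, hbound⟩ :=
    exists_cuspSymbol_operator hθ0 hθ1 hc0 hc1 hadm hg.1 hg1'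
  exact ⟨mapsTo_cuspSymbol hc0 hadm hg1', nonDegenerate_cuspSymbol hc0 hg.1,
    inBidiskAlgebra_fst inDiskAlgebra_cuspMap, inBidiskAlgebra_cuspSymbol_snd hθ0 hθ1 hg,
    cuspSymbol_one θ c g, ⟨(1, 1), ⟨(1, 1), hone, cuspSymbol_one θ c g⟩, hone⟩,
    T, hT, hcpt, ⟨τ, hτ, C, hC, hbound⟩, betaPlus_two_lt_one hτ hC hbound⟩
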